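/- **Theorem (Convergence rate of Sample-Based TRPO).** *Setting.* Let $(\mathcal S,\mathcal A,P,c,\gamma)$ be a finite discounted MDP with $S=|\mathcal S|$, $A=|\mathcal A|\ge 1$, costs $0\le c(s,a)\le C_{\max}$ and $\gamma\in(0,1)$; let $\mu,\nu$ be probability distributions on $\mathcal S$ (objective and restart distribution) and $\lambda\ge 0$. Let $\omega(x)=\frac12\|x\|_2^2$ (euclidean case) or $\omega(x)=\sum_a x_a\log x_a+\log A$ (non-euclidean case) on the simplex $\Delta_{\mathcal A}$, and $B_\omega(x,y)=\omega(x)-\omega(y)-\langle\nabla\omega(y),x-y\rangle$. For a policy $\pi$ put $c_\lambda^\pi(s)=\sum_a\pi(a|s)c(s,a)+\lambda\,\omega(\pi(\cdot|s))$, $v_\lambda^\pi=(I-\gamma P^\pi)^{-1}c_\lambda^\pi$ and $d_{\mu,\pi}=(1-\gamma)\mu(I-\gamma P^\pi)^{-1}$. Let $\pi^*$ be an optimal policy (minimising $v_\lambda^\pi(s)$ at every $s$), $v_\lambda^*=v_\lambda^{\pi^*}$, and assume $C^{\pi^*}=\max_s d_{\mu,\pi^*}(s)/\nu(s)<\infty$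 (with $0/0=0$). Constants: in the euclidean case $C_{\omega,1}=\sqrt A$, $C_{\omega,2}=C_{\omega,3}=1$, $C_{\max,\lambda}=C_{\max}+\lambda$, $r_\omega(k,\lambda)=\frac{4AC_{\max,\lambda}}{1-\gamma}$; in the non-euclidean case $C_{\omega,1}=1$, $C_{\omega,2}=A^2$, $C_{\omega,3}=\log A$, $C_{\max,\lambda}=C_{\max}+\lambda\log A$, $r_\omega(k,\lambda)=\frac{4AC_{\max,\lambda}}{1-\gamma}\bigl(1+\mathbf 1\{\lambda\ne0\}\log(k+1)\bigr)$. *Algorithm.* Let $\epsilon>0$, $\delta\in(0,1)$. Start from the uniform policy $\pi_0$. In episode $k=0,1,\dots$ draw, given the past, $M_k$ independent trajectories with $\pi_k$: restart at a state drawn from $\nu$; repeatedly accept the current state as $s_m$ with probability $1-\gamma$, or else move on by following $\pi_k$, accepting in any case after $T_k$ moves; draw $a_m$ uniformly from $\mathcal A$; roll out $T_k$ steps from $(s_m,a_m)$ following $\pi_k$, and put $\hat q_m=\sum_{t<T_k}\gamma^t\bigl(c(s_t,a_t)+\lambda\,\omega(\pi_k(\cdot|s_t))\bigr)$. At every visited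 state $s$, with $n(s)=\#\{m:s_m=s\}$, set $\hat q(s,a)=\frac{A}{n(s)}\sum_{m:(s_m,a_m)=(s,a)}\hat q_m$ and $$\pi_{k+1}(\cdot|s)=\arg\min_{x\in\Delta_{\mathcal A}}\Bigl\{t_k\bigl\langle\hat q(s,\cdot)+\lambda\nabla\omega(\pi_k(\cdot|s)),x\bigr\rangle+B_\omega\bigl(x,\pi_k(\cdot|s)\bigr)\Bigr\};$$ at the other states $\pi_{k+1}(\cdot|s)=\pi_k(\cdot|s)$. The numbers of trajectories and the truncation lengths are any natural numbers with $$M_k\ge\frac{r_\omega(k,\lambda)^2}{2\epsilon^2}\Bigl(S\log 2A+\log\frac{\pi^2(k+1)^2}{6\delta}\Bigr),\qquad T_k\ge\frac1{1-\gamma}\log\frac{8\,r_\omega(k,\lambda)}{\epsilon}$$ (in the first bound $\pi$ is the number $3.14\ldots$). Write $\mu v_{\rm best}^N=\min_{0\le k\le N}\mu v_\lambda^{\pi_k}$. *Claim.* There is an absolute constant $K>0$ such that in this setting, for every $\epsilon>0$ and $\delta\in(0,1)$, with probability greater than $1-\delta$ the following holds simultaneously for all $N\ge1$. 1. (Unregularized)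 If $\lambda=0$, $C_{\max}>0$ and $t_k=\frac{1-\gamma}{C_{\omega,1}C_{\max}\sqrt{k+1}}$, then $$\mu v_{\rm best}^N-\mu v^*\le K\Bigl(\frac{C_{\omega,1}C_{\max}\,(C_{\omega,3}+\log N)}{(1-\gamma)^2\sqrt N}+\frac{C^{\pi^*}\epsilon}{(1-\gamma)^2}\Bigr).$$ 2. (Regularized) If $\lambda>0$ and $t_k=\frac1{\lambda(k+2)}$, then $$\mu v_{\rm best}^N-\mu v_\lambda^*\le K\Bigl(\frac{C_{\omega,1}^2C_{\omega,2}C_{\max,\lambda}^2\,(1+\log N)}{\lambda(1-\gamma)^3N}+\frac{C^{\pi^*}\epsilon}{(1-\gamma)^2}\Bigr).$$ -/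

import Mathlib

open scoped ENNReal

noncomputable section

namespace TRPO

/-- A finite discounted Markov decision process with state set `S` and action set `A`:
transition kernel, costs in `[0, Cmax]` and discount factor in `(0, 1)`. -/
structure MDP (S A : Type*) [Fintype S] where
  /-- `P s a` is the law of the next state. -/
  P : S → A → stdSimplex ℝ S
  /-- the immediate cost -/
  c : S → A → ℝ
  /-- the known upper bound on the costs -/
  Cmax : ℝ
  /-- the discount factor -/
  γ : ℝ
  c_nonneg : ∀ s a, 0 ≤ c s a
  c_le : ∀ s a, c s a ≤ Cmax
  γ_pos : 0 < γ
  γ_lt_one : γ < 1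

/-- Stationary stochastic policies. -/
abbrev Policy (S A : Type*) [Fintype A] := S → stdSimplex ℝ A

/-- The two choices of the function `ω` generating the Bregman distance. -/
inductive Geometry where
  | euclidean
  | nonEuclidean

section Bregman

variable {A : Type*} [Fintype A]

/-- `ω(x) = ‖x‖₂² / 2` or `ω(x) = ∑ a, x a log (x a) + log |A|`. -/
def omega (G : Geometry) (x : stdSimplex ℝ A) : ℝ :=
  match G with
  | .euclidean => (1 / 2) * ∑ a, x a ^ 2
  | .nonEuclidean => (∑ a, x a * Real.log (x a)) + Real.log (Fintype.card A)

/-- The gradient of `ω` at `x` (in the non-euclidean case, at a point with positive coordinates). -/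
def gradOmega (G : Geometry) (x : stdSimplex ℝ A) (a : A) : ℝ :=
  match G with
  | .euclidean => x a
  | .nonEuclidean => 1 + Real.log (x a)

/-- The Bregman distance `B_ω(x, y)`. -/
def bregman (G : Geometry) (x y : stdSimplex ℝ A) : ℝ :=
  omega G x - omega G y - ∑ a, gradOmega G y a * (x a - y a)

/-- The objective of the proximal problem at one state:
`x ↦ t ⟨q + lam ∇ω(p), x⟩ + B_ω(x, p)`. -/
def proxObjective (G : Geometry) (lam t : ℝ) (p : stdSimplex ℝ A) (q : A → ℝ)
    (x : stdSimplex ℝ A) : ℝ :=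
  t * ∑ a, (q a + lam * gradOmega G p a) * x a + bregman G x p

theorem exists_proxObjective_min [Nonempty A] (G : Geometry) (lam t : ℝ) (p : stdSimplex ℝ A)
    (q : A → ℝ) : ∃ x, ∀ y, proxObjective G lam t p q x ≤ proxObjective G lam t p q y := by
  have hc : ∀ a : A, Continuous fun x : stdSimplex ℝ A => x a := fun a =>
    (continuous_apply a).comp continuous_subtype_val
  have hω : Continuous (omega (A := A) G) := by
    cases G with
    | euclidean =>
      exact continuous_const.mul (continuous_finsetSum _ fun a _ => (hc a).pow 2)
    | nonEuclidean =>
      exact (continuous_finsetSum _ fun a _ =>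
        Real.continuous_mul_log.comp (hc a)).add continuous_const
  have hobj : Continuous (proxObjective G lam t p q) := by
    unfold proxObjective bregman
    exact (continuous_const.mul
      (continuous_finsetSum _ fun a _ => continuous_const.mul (hc a))).add
      ((hω.sub continuous_const).sub
        (continuous_finsetSum _ fun a _ => continuous_const.mul ((hc a).sub continuous_const)))
  obtain ⟨x, -, hx⟩ := isCompact_univ.exists_isMinOn Set.univ_nonempty hobj.continuousOn
  exact ⟨x, fun y => hx (Set.mem_univ y)⟩

/-- The (unique) minimiser of the proximal objective over the simplex. -/
def policyUpdate [Nonempty A] (G : Geometry) (lam t : ℝ) (p : stdSimplex ℝ A) (q : A → ℝ) :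
    stdSimplex ℝ A :=
  (exists_proxObjective_min G lam t p q).choose

end Bregman

section Values

variable {S A : Type*} [Fintype S] [DecidableEq S] [Fintype A]

/-- The state transition matrix `P^π`. -/
def transition (𝓜 : MDP S A) (π : Policy S A) : Matrix S S ℝ :=
  Matrix.of fun s s' => ∑ a, π s a * 𝓜.P s a s'

/-- The regularized cost `c_λ^π(s) = ∑ a, π(a|s) c(s,a) + λ ω(π(·|s))`. -/
def cost (𝓜 : MDP S A) (G : Geometry) (lam : ℝ) (π : Policy S A) (s : S) : ℝ :=
  ∑ a, π s a * 𝓜.c s a + lam * omega G (π s)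

/-- The value `v_λ^π = (I - γ P^π)⁻¹ c_λ^π`. -/
def value (𝓜 : MDP S A) (G : Geometry) (lam : ℝ) (π : Policy S A) : S → ℝ :=
  Matrix.mulVec (1 - 𝓜.γ • transition 𝓜 π)⁻¹ (cost 𝓜 G lam π)

/-- The scalar objective `μ v_λ^π`. -/
def scalarValue (𝓜 : MDP S A) (μ : stdSimplex ℝ S) (G : Geometry) (lam : ℝ) (π : Policy S A) : ℝ :=
  ∑ s, μ s * value 𝓜 G lam π s

/-- `π` is an optimal policy: it minimises `v_λ^π(s)` simultaneously at all states. -/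
def IsOptimal (𝓜 : MDP S A) (G : Geometry) (lam : ℝ) (π : Policy S A) : Prop :=
  ∀ (π' : Policy S A) (s : S), value 𝓜 G lam π s ≤ value 𝓜 G lam π' s

/-- The discounted visitation frequency `d_{μ,π} = (1 - γ) μ (I - γ P^π)⁻¹`. -/
def visitation (𝓜 : MDP S A) (μ : stdSimplex ℝ S) (π : Policy S A) : S → ℝ :=
  (1 - 𝓜.γ) • Matrix.vecMul μ (1 - 𝓜.γ • transition 𝓜 π)⁻¹

/-- The concentrability coefficient `max_s d_{μ,π}(s) / ν(s)`, with `0 / 0 = 0` and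
`x / 0 = ∞` for `x > 0`. -/
def concentrability (𝓜 : MDP S A) (μ ν : stdSimplex ℝ S) (π : Policy S A) : ℝ≥0∞ :=
  ⨆ s, ENNReal.ofReal (visitation 𝓜 μ π s) / ENNReal.ofReal (ν s)

end Values

section Sampling

/-- A point of the simplex as a probability mass function. -/
def toPMF {α : Type*} [Fintype α] (x : stdSimplex ℝ α) : PMF α :=
  PMF.ofFintype (fun a => ENNReal.ofReal (x a)) (by
    rw [← ENNReal.ofReal_sum_of_nonneg fun a _ => stdSimplex.zero_le x a, stdSimplex.sum_eq_one,
      ENNReal.ofReal_one])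

variable {S A : Type*} [Fintype S] [Fintype A]

/-- The coin which shows `true` (accept the current state) with probability `1 - γ`. -/
def acceptCoin (𝓜 : MDP S A) : PMF Bool :=
  PMF.ofFintype (fun b => if b then ENNReal.ofReal (1 - 𝓜.γ) else ENNReal.ofReal 𝓜.γ) (by
    rw [Fintype.sum_bool, if_pos rfl, if_neg Bool.false_ne_true,
      ← ENNReal.ofReal_add (sub_nonneg.2 𝓜.γ_lt_one.le) 𝓜.γ_pos.le, sub_add_cancel,
      ENNReal.ofReal_one])

/-- Starting at `s`: accept the current state with probability `1 - γ`, otherwise move on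
by following `π`; after `T` moves accept the current state in any case. -/
def sampleState (𝓜 : MDP S A) (π : Policy S A) : ℕ → S → PMF S
  | 0, s => PMF.pure s
  | T + 1, s => (acceptCoin 𝓜).bind fun accept =>
      if accept then PMF.pure s
      else (toPMF (π s)).bind fun a => (toPMF (𝓜.P s a)).bind fun s' => sampleState 𝓜 π T s'

/-- The rollout truncated after `T` steps: the law of
`∑_{t < T} γ^t (c(s_t, a_t) + λ ω(π(·|s_t)))` where `(s_0, a_0) = (s, a)` and then `π` is followed. -/
def rollout (𝓜 : MDP S A) (G : Geometry) (lam : ℝ) (π : Policy S A) : ℕ → S → A → PMF ℝ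
  | 0, _, _ => PMF.pure 0
  | T + 1, s, a => (toPMF (𝓜.P s a)).bind fun s' => (toPMF (π s')).bind fun a' =>
      (rollout 𝓜 G lam π T s' a').map fun r => 𝓜.c s a + lam * omega G (π s) + 𝓜.γ * r

/-- One sampled trajectory `(s_m, a_m, q̂(s_m, a_m, m))` in the `ν`-restart model: restart from `ν`,
choose the state `s_m`, draw a uniform action `a_m`, and roll out `T` steps with `π`. -/
def trajectory [Nonempty A] (𝓜 : MDP S A) (ν : stdSimplex ℝ S) (G : Geometry) (lam : ℝ) (T : ℕ)
    (π : Policy S A) : PMF (S × A × ℝ) :=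
  (toPMF ν).bind fun s₀ => (sampleState 𝓜 π T s₀).bind fun s =>
    (PMF.uniformOfFintype A).bind fun a => (rollout 𝓜 G lam π T s a).map fun q => (s, a, q)

end Sampling

section Algorithm

variable {S A : Type*} [Fintype A] [DecidableEq S] [DecidableEq A]

/-- `q̂(s,a) = |A| / n(s) * ∑_{m : (s_m, a_m) = (s, a)} q̂(s_m, a_m, m)`, where `n(s)` is the number
of trajectories with `s_m = s`. -/
def qHat {M : ℕ} (x : Fin M → S × A × ℝ) (s : S) (a : A) : ℝ :=
  (Fintype.card A : ℝ) * (∑ m, if (x m).1 = s ∧ (x m).2.1 = a then (x m).2.2 else 0) /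
    (∑ m, if (x m).1 = s then 1 else 0)

/-- The update at the end of an episode with samples `x`: the proximal step at every visited state,
and no change at the other states. -/
def nextPolicy [Nonempty A] (G : Geometry) (lam t : ℝ) (π : Policy S A) {M : ℕ}
    (x : Fin M → S × A × ℝ) : Policy S A := fun s =>
  if ∃ m, (x m).1 = s then policyUpdate G lam t (π s) (qHat x s) else π s

/-- The policies `π_0, π_1, …` computed from the batches `x_0, x_1, …` of samples; `π_0` is uniform
and `π_k` depends on `x_j` for `j < k` only. -/
def policySeq [Nonempty A] (G : Geometry) (lam : ℝ) (t : ℕ → ℝ) {M : ℕ → ℕ}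
    (x : ∀ k, Fin (M k) → S × A × ℝ) : ℕ → Policy S A
  | 0 => fun _ => stdSimplex.barycenter
  | k + 1 => nextPolicy G lam (t k) (policySeq G lam t x k) (x k)

/-- The random batches `X k`, `k = 0, 1, …`, are those of a run of the algorithm with stepsizes `t k`,
`M k` trajectories in episode `k`, and truncation length `T k`: given the previous batches, the
members of `X k` are independent trajectories sampled with the current policy. -/
structure IsRun [Fintype S] [Nonempty A] {Ω : Type*} [MeasurableSpace Ω]
    (ℙ : MeasureTheory.Measure Ω) (𝓜 : MDP S A) (ν : stdSimplex ℝ S) (G : Geometry) (lam : ℝ)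
    (t : ℕ → ℝ) (M T : ℕ → ℕ) (X : ∀ k, Ω → Fin (M k) → S × A × ℝ) : Prop where
  measurableSet_eq : ∀ k x, MeasurableSet {ω | X k ω = x}
  law : ∀ (n : ℕ) (x : ∀ k, Fin (M k) → S × A × ℝ),
    ℙ {ω | ∀ k < n, X k ω = x k} =
      ∏ k ∈ Finset.range n, ∏ m, trajectory 𝓜 ν G lam (T k) (policySeq G lam t x k) (x k m)

/-- The best value `min_{k = 0, …, N} μ v_λ^{π_k}` among the first policies of a sequence. -/
def bestValue [Fintype S] (𝓜 : MDP S A) (μ : stdSimplex ℝ S) (G : Geometry) (lam : ℝ)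
    (π : ℕ → Policy S A) (N : ℕ) : ℝ :=
  (Finset.range (N + 1)).inf' Finset.nonempty_range_add_one fun k => scalarValue 𝓜 μ G lam (π k)

end Algorithm

section Constants

/-- `C_{ω,1}` for `A` actions. -/
def cOmega1 (G : Geometry) (A : ℕ) : ℝ :=
  match G with
  | .euclidean => √A
  | .nonEuclidean => 1

/-- `C_{ω,2}` for `A` actions. -/
def cOmega2 (G : Geometry) (A : ℕ) : ℝ :=
  match G with
  | .euclidean => 1
  | .nonEuclidean => (A : ℝ) ^ 2

/-- `C_{ω,3}` for `A` actions. -/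
def cOmega3 (G : Geometry) (A : ℕ) : ℝ :=
  match G with
  | .euclidean => 1
  | .nonEuclidean => Real.log A

/-- `C_{max,λ}`: the bound on the regularized cost. -/
def cMaxReg (G : Geometry) (A : ℕ) (Cmax lam : ℝ) : ℝ :=
  match G with
  | .euclidean => Cmax + lam
  | .nonEuclidean => Cmax + lam * Real.log A

/-- `r_ω(k,λ)`: `4 A C_{max,λ} / (1 - γ)`, with an extra factor `1 + log (k + 1)` in the regularized
non-euclidean case. -/
def rOmega (G : Geometry) (A : ℕ) (Cmax γ lam : ℝ) (k : ℕ) : ℝ :=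
  4 * A * cMaxReg G A Cmax lam / (1 - γ) *
    match G with
    | .euclidean => 1
    | .nonEuclidean => if lam = 0 then 1 else 1 + Real.log (k + 1)

/-- The number `M k` of trajectories in each episode `k` is large enough for accuracy `ε` and
confidence `δ`, with `S` states and `A` actions. -/
def EnoughTrajectories (G : Geometry) (S A : ℕ) (Cmax γ lam ε δ : ℝ) (M : ℕ → ℕ) : Prop :=
  ∀ k : ℕ, rOmega G A Cmax γ lam k ^ 2 / (2 * ε ^ 2) *
    (S * Real.log (2 * A) + Real.log (Real.pi ^ 2 * (k + 1) ^ 2 / (6 * δ))) ≤ M k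

/-- The truncation length `T k` in each episode `k` is large enough for accuracy `ε`. -/
def LongEnough (G : Geometry) (A : ℕ) (Cmax γ lam ε : ℝ) (T : ℕ → ℕ) : Prop :=
  ∀ k : ℕ, 1 / (1 - γ) * Real.log (8 * rOmega G A Cmax γ lam k / ε) ≤ T k

end Constants

end TRPO

end

/-! At every state the algorithm runs mirror descent on the simplex. The states are tied together
only by the performance difference identity `sum_visitation_mul_bellmanGap`: (1-γ)(μv^π - μv^π') is
the Bellman gap averaged over the visitation frequency of the comparator π'. By `bellmanGap_eq` that
gap is the linearised loss ⟨q + λ∇ω(π), π - π'⟩ minus λB(π', π). With the comparator π* fixed, the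
averaging measure d does not change with the episode, so the one-step inequality
`policyUpdate_descent` averages to a recursion for the single number Φ_k = ∑ d(s) B(π*(s), π_k(s)),
proved in `potential_recursion`: t_k (1-γ) Δ_k ≤ (1 - λt_k) Φ_k - Φ_{k+1} + t_k² H/2 + t_k ·
8Cε/(1-γ), where Δ_k is the suboptimality of π_k, C the concentrability coefficient and H a bound on
squared dual norms of gradients. Telescoping it with the two stepsize rules
(`rate_of_recursion_sqrt`, `rate_of_recursion_inv`) gives the two rates.

The estimated action values need not be accurate at each state, only on average over the law p of
the sampled states (`GoodBatch.exists_error`). Let α pick the worst action and σ the sign of the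
error at every state. The visit-weighted total error is then a sum of independent bounded centred
terms for each fixed pair (α, σ), and a union bound over the (2A)^S pairs suffices. This is the
source of the term S log 2A in the number of trajectories. A second family of deviations controls
the mass of states visited less often than expected. A state never visited keeps its policy, and its
whole possible loss is charged as error. Passing from p to d costs C/(1-γ), because a restart state
is accepted at once with probability at least 1-γ.

In the entropic geometry gradients could be unbounded near the boundary; `LogOscLe` is an invariant
that keeps λ log π_k of bounded oscillation uniformly in k.

Given the history, the batch of episode k consists of independent draws (`IsRun.measure_bad_le`), so
it is bad with probability at most a quarter of 6δ/(π²(k+1)²). These numbers sum to δ/4, and outside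
that event the bounds hold for all N at once. -/

noncomputable section

namespace TRPO

/-! ### The proximal step: explicit form, optimality, one-step inequality. -/

section Mirror

/-- On [-R, R] the exponential lies below its chord cosh R + (sinh R / R) f, and cosh R ≤ exp(R²/2).
Having c independent of f is the point: the linear term vanishes for centred variables. Both the
entropic step and the concentration bound rest on this. -/
theorem exists_exp_le_affine {R : ℝ} (hR : 0 ≤ R) :
    ∃ c : ℝ, ∀ f : ℝ, |f| ≤ R → Real.exp f ≤ Real.exp (R ^ 2 / 2) + c * f := by
  rcases hR.eq_or_lt with rfl | hR
  · refine ⟨0, fun f hf => ?_⟩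
    have : f = 0 := abs_nonpos_iff.1 hf
    simp [this]
  refine ⟨Real.sinh R / R, fun f hf => ?_⟩
  obtain ⟨h1, h2⟩ := abs_le.1 hf
  have hconv := convexOn_exp.2 (Set.mem_univ R) (Set.mem_univ (-R))
    (show 0 ≤ (R + f) / (2 * R) by apply div_nonneg <;> linarith)
    (show 0 ≤ (R - f) / (2 * R) by apply div_nonneg <;> linarith)
    (by field_simp; ring)
  have hf' : (R + f) / (2 * R) * R + (R - f) / (2 * R) * (-R) = f := by
    field_simp; ring
  simp only [smul_eq_mul] at hconv
  rw [hf'] at hconv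
  have hcosh := Real.cosh_le_exp_half_sq R
  refine hconv.trans ?_
  have : (R + f) / (2 * R) * Real.exp R + (R - f) / (2 * R) * Real.exp (-R)
      = Real.cosh R + Real.sinh R / R * f := by
    rw [Real.cosh_eq, Real.sinh_eq]; field_simp; ring
  rw [this]; linarith

variable {A : Type*} [Fintype A]

theorem mul_log_sub_log_ge {x y : ℝ} (hx : 0 ≤ x) (hy : 0 < y) :
    x - y ≤ x * (Real.log x - Real.log y) := by
  rcases hx.eq_or_lt with rfl | hx
  · simp [hy.le]
  have h := Real.log_le_sub_one_of_pos (div_pos hy hx)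
  rw [Real.log_div hy.ne' hx.ne'] at h
  have := mul_le_mul_of_nonneg_left h hx.le
  have e : x * (y / x - 1) = y - x := by field_simp
  rw [e] at this
  linarith

theorem eq_of_mul_log_sub_log_le {x y : ℝ} (hx : 0 ≤ x) (hy : 0 < y)
    (h : x * (Real.log x - Real.log y) ≤ x - y) : x = y := by
  rcases hx.eq_or_lt with rfl | hx
  · simp at h; linarith
  by_contra hne
  have h1 : y / x ≠ 1 := fun h1 => hne ((div_eq_one_iff_eq hx.ne').1 h1).symm
  have h2 := Real.log_lt_sub_one_of_pos (div_pos hy hx) h1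
  rw [Real.log_div hy.ne' hx.ne'] at h2
  have := mul_lt_mul_of_pos_left h2 hx
  have e : x * (y / x - 1) = y - x := by field_simp
  rw [e] at this
  linarith

theorem bregman_euclidean (x y : stdSimplex ℝ A) :
    bregman .euclidean x y = 1 / 2 * ∑ a, (x a - y a) ^ 2 := by
  simp only [bregman, omega, gradOmega]
  rw [← mul_sub, ← Finset.sum_sub_distrib, Finset.mul_sum, Finset.mul_sum,
    ← Finset.sum_sub_distrib]
  exact Finset.sum_congr rfl fun a _ => by ring

theorem bregman_nonEuclidean (x y : stdSimplex ℝ A) :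
    bregman .nonEuclidean x y = ∑ a, x a * (Real.log (x a) - Real.log (y a)) := by
  simp only [bregman, omega, gradOmega]
  have h : ∑ a, (1 + Real.log (y a)) * (x a - y a)
      = ∑ a, x a * Real.log (y a) - ∑ a, y a * Real.log (y a) := by
    have : ∀ a, (1 + Real.log (y a)) * (x a - y a)
      = x a - y a + (x a * Real.log (y a) - y a * Real.log (y a)) := fun a => by ring
    simp_rw [this, Finset.sum_add_distrib, Finset.sum_sub_distrib, stdSimplex.sum_eq_one]
    ring
  rw [h]
  simp_rw [mul_sub, Finset.sum_sub_distrib]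
  ring

/-- Interior points of the simplex are required in the non-euclidean geometry only. -/
def IsInterior (G : Geometry) (p : stdSimplex ℝ A) : Prop :=
  G = .nonEuclidean → ∀ a, 0 < p a

theorem bregman_nonneg (G : Geometry) (x y : stdSimplex ℝ A) (hy : IsInterior G y) :
    0 ≤ bregman G x y := by
  cases G with
  | euclidean => rw [bregman_euclidean]; positivity
  | nonEuclidean =>
    rw [bregman_nonEuclidean]
    have h := Finset.sum_le_sum fun a (_ : a ∈ Finset.univ) =>
      mul_log_sub_log_ge (stdSimplex.zero_le x a) (hy rfl a)
    rw [Finset.sum_sub_distrib, stdSimplex.sum_eq_one, stdSimplex.sum_eq_one] at h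
    linarith

/-- `H` bounds the square of the dual norm of `g`: the euclidean norm, or the oscillation. -/
def DualBound (G : Geometry) (g : A → ℝ) (H : ℝ) : Prop :=
  match G with
  | .euclidean => ∑ a, g a ^ 2 ≤ H
  | .nonEuclidean => ∀ a b, (g a - g b) ^ 2 ≤ H

/-- Hoeffding's lemma for g under p. The mean is a convex combination of values of g, so every
deviation from it is at most √H. -/
theorem sum_mul_exp_le (p : stdSimplex ℝ A) (g : A → ℝ) {H : ℝ}
    (hH : ∀ a b, (g a - g b) ^ 2 ≤ H) (t : ℝ) :
    ∑ a, p a * Real.exp (-t * g a) ≤ Real.exp (-t * ∑ a, p a * g a + t ^ 2 * H / 2) := by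
  rcases isEmpty_or_nonempty A with hA | ⟨⟨a₀⟩⟩
  · simp [Real.exp_nonneg]
  have hH0 : 0 ≤ H := by simpa using hH a₀ a₀
  set m := ∑ a, p a * g a with hm
  have hdev : ∀ a, |-t * (g a - m)| ≤ |t| * √H := by
    intro a
    rw [abs_mul, abs_neg]
    refine mul_le_mul_of_nonneg_left ?_ (abs_nonneg t)
    have : g a - m = ∑ b, p b * (g a - g b) := by
      simp_rw [mul_sub, Finset.sum_sub_distrib, ← Finset.sum_mul, stdSimplex.sum_eq_one]
      rw [hm]; ring
    rw [this]
    calc |∑ b, p b * (g a - g b)| ≤ ∑ b, |p b * (g a - g b)| := Finset.abs_sum_le_sum_abs _ _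
      _ ≤ ∑ b, p b * √H := by
          refine Finset.sum_le_sum fun b _ => ?_
          rw [abs_mul, abs_of_nonneg (stdSimplex.zero_le p b)]
          exact mul_le_mul_of_nonneg_left (Real.abs_le_sqrt (hH a b)) (stdSimplex.zero_le p b)
      _ = √H := by rw [← Finset.sum_mul, stdSimplex.sum_eq_one, one_mul]
  obtain ⟨c, hc⟩ := exists_exp_le_affine (mul_nonneg (abs_nonneg t) (Real.sqrt_nonneg H))
  have hsq : (|t| * √H) ^ 2 / 2 = t ^ 2 * H / 2 := by
    rw [mul_pow, sq_abs, Real.sq_sqrt hH0]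
  rw [hsq] at hc
  have key : ∑ a, p a * Real.exp (-t * (g a - m)) ≤ Real.exp (t ^ 2 * H / 2) := by
    calc ∑ a, p a * Real.exp (-t * (g a - m))
        ≤ ∑ a, p a * (Real.exp (t ^ 2 * H / 2) + c * (-t * (g a - m))) :=
          Finset.sum_le_sum fun a _ =>
            mul_le_mul_of_nonneg_left (hc _ (hdev a)) (stdSimplex.zero_le p a)
      _ = ∑ a, (p a * (Real.exp (t ^ 2 * H / 2) + c * t * m) - c * t * (p a * g a)) :=
          Finset.sum_congr rfl fun a _ => by ring
      _ = Real.exp (t ^ 2 * H / 2) := by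
          rw [Finset.sum_sub_distrib, ← Finset.sum_mul, ← Finset.mul_sum, stdSimplex.sum_eq_one,
            ← hm]
          ring
  rw [Real.exp_add]
  have : ∑ a, p a * Real.exp (-t * g a) =
      Real.exp (-t * m) * ∑ a, p a * Real.exp (-t * (g a - m)) := by
    rw [Finset.mul_sum]
    refine Finset.sum_congr rfl fun a _ => ?_
    rw [show -t * g a = -t * m + -t * (g a - m) by ring, Real.exp_add]; ring
  rw [this]
  exact mul_le_mul_of_nonneg_left key (Real.exp_nonneg _)

theorem abs_sum_mul_simplex_le {e : ℝ} {u : A → ℝ} (hu : ∀ a, |u a| ≤ e) (x : stdSimplex ℝ A) :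
    |∑ a, u a * x a| ≤ e := by
  calc |∑ a, u a * x a| ≤ ∑ a, |u a * x a| := Finset.abs_sum_le_sum_abs _ _
    _ ≤ ∑ a, e * x a := Finset.sum_le_sum fun a _ => by
        rw [abs_mul, abs_of_nonneg (stdSimplex.zero_le x a)]
        exact mul_le_mul_of_nonneg_right (hu a) (stdSimplex.zero_le x a)
    _ = e := by rw [← Finset.mul_sum, stdSimplex.sum_eq_one, mul_one]

variable [Nonempty A]

theorem policyUpdate_le (G : Geometry) (lam t : ℝ) (p : stdSimplex ℝ A) (q : A → ℝ)
    (y : stdSimplex ℝ A) :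
    proxObjective G lam t p q (policyUpdate G lam t p q) ≤ proxObjective G lam t p q y :=
  (exists_proxObjective_min G lam t p q).choose_spec y

/-- The normalising constant of the exponentiated gradient step. -/
def partition (t : ℝ) (p : stdSimplex ℝ A) (g : A → ℝ) : ℝ :=
  ∑ a, p a * Real.exp (-t * g a)

theorem partition_pos (t : ℝ) (p : stdSimplex ℝ A) (g : A → ℝ) (hp : ∀ a, 0 < p a) :
    0 < partition t p g :=
  Finset.sum_pos (fun a _ => mul_pos (hp a) (Real.exp_pos _)) Finset.univ_nonempty

/-- With y the exponentiated gradient point, the objective is KL(x‖y) - log Z. A minimiser therefore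
has KL(x‖y) ≤ 0, which forces equality in each of the termwise bounds x - y ≤ x log(x/y), hence x =
y. -/
theorem policyUpdate_nonEuclidean (lam t : ℝ) (p : stdSimplex ℝ A) (q : A → ℝ)
    (hp : ∀ a, 0 < p a) (a : A) :
    policyUpdate .nonEuclidean lam t p q a =
      p a * Real.exp (-t * (q a + lam * gradOmega .nonEuclidean p a)) /
        partition t p (fun a => q a + lam * gradOmega .nonEuclidean p a) := by
  set g : A → ℝ := fun a => q a + lam * gradOmega .nonEuclidean p a with hg
  have hZ := partition_pos t p g hp
  set Z := partition t p g
  let y : stdSimplex ℝ A := ⟨fun a => p a * Real.exp (-t * g a) / Z,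
    fun a => div_nonneg (mul_nonneg (hp a).le (Real.exp_nonneg _)) hZ.le,
    by rw [← Finset.sum_div]; exact div_self hZ.ne'⟩
  have hy : ∀ a, y a = p a * Real.exp (-t * g a) / Z := fun _ => rfl
  have hypos : ∀ a, 0 < y a := fun a => div_pos (mul_pos (hp a) (Real.exp_pos _)) hZ
  have hlog : ∀ a, Real.log (y a) = Real.log (p a) - t * g a - Real.log Z := by
    intro a
    rw [hy, Real.log_div (mul_pos (hp a) (Real.exp_pos _)).ne' hZ.ne',
      Real.log_mul (hp a).ne' (Real.exp_ne_zero _), Real.log_exp]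
    ring
  have hobj : ∀ x : stdSimplex ℝ A, proxObjective .nonEuclidean lam t p q x =
      ∑ a, x a * (Real.log (x a) - Real.log (y a)) - Real.log Z := by
    intro x
    rw [proxObjective, bregman_nonEuclidean, Finset.mul_sum, ← Finset.sum_add_distrib]
    have : Real.log Z = ∑ a, x a * Real.log Z := by
      rw [← Finset.sum_mul, stdSimplex.sum_eq_one, one_mul]
    rw [this, ← Finset.sum_sub_distrib]
    refine Finset.sum_congr rfl fun a _ => ?_
    rw [hlog]
    simp only [hg]
    ring
  have hmin := policyUpdate_le .nonEuclidean lam t p q y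
  rw [hobj, hobj] at hmin
  set x := policyUpdate .nonEuclidean lam t p q
  simp only [sub_self, mul_zero, Finset.sum_const_zero] at hmin
  have hle : ∀ a ∈ Finset.univ, x a - y a ≤ x a * (Real.log (x a) - Real.log (y a)) :=
    fun a _ => mul_log_sub_log_ge (stdSimplex.zero_le x a) (hypos a)
  have hsum : ∑ a, (x a - y a) = ∑ a, x a * (Real.log (x a) - Real.log (y a)) := by
    refine le_antisymm (Finset.sum_le_sum hle) ?_
    rw [Finset.sum_sub_distrib, stdSimplex.sum_eq_one, stdSimplex.sum_eq_one]
    linarith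
  have heq := (Finset.sum_eq_sum_iff_of_le hle).1 hsum a (Finset.mem_univ a)
  rw [eq_of_mul_log_sub_log_le (stdSimplex.zero_le x a) (hypos a) heq.ge, hy]

theorem log_policyUpdate (lam t : ℝ) (p : stdSimplex ℝ A) (q : A → ℝ)
    (hp : ∀ a, 0 < p a) (a : A) :
    Real.log (policyUpdate .nonEuclidean lam t p q a) =
      Real.log (p a) - t * (q a + lam * gradOmega .nonEuclidean p a) -
        Real.log (partition t p (fun a => q a + lam * gradOmega .nonEuclidean p a)) := by
  rw [policyUpdate_nonEuclidean lam t p q hp, Real.log_div (mul_pos (hp a) (Real.exp_pos _)).ne'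
    (partition_pos t p _ hp).ne', Real.log_mul (hp a).ne' (Real.exp_ne_zero _), Real.log_exp]
  ring

theorem isInterior_policyUpdate (G : Geometry) (lam t : ℝ) (p : stdSimplex ℝ A) (q : A → ℝ)
    (hp : IsInterior G p) : IsInterior G (policyUpdate G lam t p q) := by
  rintro rfl a
  rw [policyUpdate_nonEuclidean lam t p q (hp rfl)]
  exact div_pos (mul_pos (hp rfl a) (Real.exp_pos _)) (partition_pos t p _ (hp rfl))

/-- First-order optimality: along the segment from the minimiser to x the objective grows by s(I +
sQ), so I + sQ ≥ 0 for all small s > 0. -/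
theorem policyUpdate_euclidean_optimality (lam t : ℝ) (p : stdSimplex ℝ A) (q : A → ℝ)
    (x : stdSimplex ℝ A) :
    0 ≤ ∑ a, (t * (q a + lam * gradOmega .euclidean p a) +
      (policyUpdate .euclidean lam t p q a - p a)) * (x a - policyUpdate .euclidean lam t p q a) := by
  have hmin := policyUpdate_le .euclidean lam t p q
  set y := policyUpdate .euclidean lam t p q
  set g : A → ℝ := fun a => q a + lam * gradOmega .euclidean p a with hg
  set I := ∑ a, (t * g a + (y a - p a)) * (x a - y a) with hI
  set Q := 1 / 2 * ∑ a, (x a - y a) ^ 2 with hQ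
  have hQ0 : 0 ≤ Q := by positivity
  have key : ∀ s : ℝ, 0 < s → s ≤ 1 → 0 ≤ I + s * Q := by
    intro s hs0 hs1
    let z : stdSimplex ℝ A := ⟨fun a => (1 - s) * y a + s * x a,
      fun a => add_nonneg (mul_nonneg (by linarith) (stdSimplex.zero_le y a))
        (mul_nonneg hs0.le (stdSimplex.zero_le x a)), by
        rw [Finset.sum_add_distrib, ← Finset.mul_sum, ← Finset.mul_sum, stdSimplex.sum_eq_one,
          stdSimplex.sum_eq_one]; ring⟩
    have hz : ∀ a, z a = (1 - s) * y a + s * x a := fun _ => rfl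
    have h := hmin z
    simp only [proxObjective, bregman_euclidean] at h
    have hdiff : t * ∑ a, g a * z a + 1 / 2 * ∑ a, (z a - p a) ^ 2
        - (t * ∑ a, g a * y a + 1 / 2 * ∑ a, (y a - p a) ^ 2) = s * (I + s * Q) := by
      rw [hI, hQ]
      simp only [Finset.mul_sum, ← Finset.sum_add_distrib, ← Finset.sum_sub_distrib]
      refine Finset.sum_congr rfl fun a _ => ?_
      rw [hz]; ring
    have : 0 ≤ s * (I + s * Q) := by rw [← hdiff]; linarith
    exact nonneg_of_mul_nonneg_right this hs0
  by_contra hneg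
  push Not at hneg
  rcases hQ0.eq_or_lt with h0 | hQpos
  · have := key 1 one_pos le_rfl
    rw [← h0] at this; linarith
  -- At this s the quadratic term makes up for at most half of the negative slope I.
  · have hs : 0 < min 1 (-I / (2 * Q)) := lt_min one_pos (div_pos (by linarith) (by linarith))
    have h1 := key _ hs (min_le_left _ _)
    have h2 : min 1 (-I / (2 * Q)) * Q ≤ -I / (2 * Q) * Q :=
      mul_le_mul_of_nonneg_right (min_le_right _ _) hQ0
    have h3 : -I / (2 * Q) * Q = -I / 2 := by field_simp
    linarith

/-- One proximal step with an inexact gradient. -/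
theorem policyUpdate_descent (G : Geometry) {lam t e H : ℝ} (ht : 0 < t) (p : stdSimplex ℝ A)
    (hp : IsInterior G p) (q qh : A → ℝ) (he : ∀ a, |qh a - q a| ≤ e)
    (hH : DualBound G (fun a => q a + lam * gradOmega G p a) H) (x : stdSimplex ℝ A) :
    t * ∑ a, (q a + lam * gradOmega G p a) * (p a - x a) ≤
      bregman G x p - bregman G x (policyUpdate G lam t p qh) + t ^ 2 * H / 2 + t * (2 * e) := by
  cases G with
  | nonEuclidean =>
    replace hp := hp rfl
    set g : A → ℝ := fun a => q a + lam * gradOmega .nonEuclidean p a with hg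
    set gh : A → ℝ := fun a => qh a + lam * gradOmega .nonEuclidean p a with hgh
    have hlog := log_policyUpdate lam t p qh hp
    set y := policyUpdate .nonEuclidean lam t p qh
    have hZ := partition_pos t p gh hp
    set Z := partition t p gh with hZdef
    have h1 : bregman .nonEuclidean x p - bregman .nonEuclidean x y =
        -t * (∑ a, g a * x a) - t * (∑ a, (qh a - q a) * x a) - Real.log Z := by
      rw [bregman_nonEuclidean, bregman_nonEuclidean, ← Finset.sum_sub_distrib]
      have : Real.log Z = ∑ a, x a * Real.log Z := by
        rw [← Finset.sum_mul, stdSimplex.sum_eq_one, one_mul]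
      rw [this]
      simp only [Finset.mul_sum, ← Finset.sum_sub_distrib]
      refine Finset.sum_congr rfl fun a _ => ?_
      rw [hlog]
      simp only [hg]
      ring
    -- The gradient error enters twice: here through the normalising constant and in `h5` through
    -- the pairing with x. Hence the 2e.
    have h2 : Z ≤ Real.exp (t * e) * partition t p g := by
      rw [hZdef, partition, partition, Finset.mul_sum]
      refine Finset.sum_le_sum fun a _ => ?_
      rw [mul_left_comm, ← Real.exp_add]
      refine mul_le_mul_of_nonneg_left (Real.exp_le_exp.2 ?_) (hp a).le
      have := mul_le_mul_of_nonneg_left (neg_le_of_abs_le (he a)) ht.le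
      simp only [hg, hgh]
      linarith
    have h3 : Z ≤ Real.exp (t * e + (-t * ∑ a, p a * g a + t ^ 2 * H / 2)) := by
      rw [Real.exp_add]
      exact h2.trans (mul_le_mul_of_nonneg_left (sum_mul_exp_le p g hH t) (Real.exp_nonneg _))
    have h4 := (Real.log_le_iff_le_exp hZ).2 h3
    have h5 := mul_le_mul_of_nonneg_left (le_of_abs_le (abs_sum_mul_simplex_le he x)) ht.le
    have h6 : ∑ a, g a * (p a - x a) = ∑ a, p a * g a - ∑ a, g a * x a := by
      rw [← Finset.sum_sub_distrib]; exact Finset.sum_congr rfl fun a _ => by ring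
    rw [h1, h6]
    linarith
  | euclidean =>
    have hopt := policyUpdate_euclidean_optimality lam t p qh x
    set y := policyUpdate .euclidean lam t p qh
    set g : A → ℝ := fun a => q a + lam * gradOmega .euclidean p a with hg
    replace hH : ∑ a, g a ^ 2 ≤ H := hH
    rw [bregman_euclidean, bregman_euclidean]
    have hx := mul_le_mul_of_nonneg_left (le_of_abs_le (abs_sum_mul_simplex_le he x)) ht.le
    have hy := mul_le_mul_of_nonneg_left (neg_le_of_abs_le (abs_sum_mul_simplex_le he y)) ht.le
    have hsq : 0 ≤ ∑ a, (t * g a - (p a - y a)) ^ 2 := by positivity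
    have hH' := mul_le_mul_of_nonneg_left hH (sq_nonneg t)
    -- Completing the square in t g - (p - y) isolates the optimality term, the two distances and
    -- the gradient error, tested at x and at y.
    have hid : t * ∑ a, g a * (p a - x a) =
        -(∑ a, (t * (qh a + lam * gradOmega .euclidean p a) + (y a - p a)) * (x a - y a))
        + (1 / 2 * ∑ a, (x a - p a) ^ 2 - 1 / 2 * ∑ a, (x a - y a) ^ 2)
        - 1 / 2 * ∑ a, (t * g a - (p a - y a)) ^ 2 + 1 / 2 * (t ^ 2 * ∑ a, g a ^ 2)
        + (t * ∑ a, (qh a - q a) * x a - t * ∑ a, (qh a - q a) * y a) := by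
      simp only [Finset.mul_sum, ← Finset.sum_add_distrib, ← Finset.sum_sub_distrib,
        ← Finset.sum_neg_distrib]
      refine Finset.sum_congr rfl fun a _ => ?_
      simp only [hg]
      ring
    linarith

end Mirror

/-! ### Bounds on ω, on Bregman distances and on gradients. -/

section OmegaBounds

variable {A : Type*} [Fintype A] [Nonempty A]

theorem cMaxReg_eq (G : Geometry) (n : ℕ) (C lam : ℝ) :
    cMaxReg G n C lam = C + lam * cOmega3 G n := by
  cases G <;> simp [cMaxReg, cOmega3]

theorem cOmega3_nonneg (G : Geometry) (n : ℕ) : 0 ≤ cOmega3 G n := by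
  cases G with
  | euclidean => exact zero_le_one
  | nonEuclidean => exact Real.log_natCast_nonneg n

theorem barycenter_coe (a : A) :
    (stdSimplex.barycenter : stdSimplex ℝ A) a = (Fintype.card A : ℝ)⁻¹ :=
  stdSimplex.barycenter_apply a

theorem omega_nonEuclidean_eq_bregman (x : stdSimplex ℝ A) :
    omega .nonEuclidean x = bregman .nonEuclidean x stdSimplex.barycenter := by
  rw [bregman_nonEuclidean]
  simp only [omega, barycenter_coe, Real.log_inv, mul_sub, Finset.sum_sub_distrib,
    ← Finset.sum_mul, stdSimplex.sum_eq_one]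
  ring

theorem isInterior_barycenter (G : Geometry) :
    IsInterior G (stdSimplex.barycenter : stdSimplex ℝ A) := by
  intro _ a
  rw [barycenter_coe]
  exact inv_pos.2 (by exact_mod_cast Fintype.card_pos)

theorem omega_nonneg (G : Geometry) (x : stdSimplex ℝ A) : 0 ≤ omega G x := by
  cases G with
  | euclidean => simp only [omega]; positivity
  | nonEuclidean =>
    rw [omega_nonEuclidean_eq_bregman]
    exact bregman_nonneg _ _ _ (isInterior_barycenter _)

omit [Nonempty A] in
theorem sum_sq_le_one (x : stdSimplex ℝ A) : ∑ a, x a ^ 2 ≤ 1 := by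
  rw [← stdSimplex.sum_eq_one x]
  refine Finset.sum_le_sum fun a _ => ?_
  have h1 := stdSimplex.le_one x a
  have h0 := stdSimplex.zero_le x a
  nlinarith

omit [Nonempty A] in
theorem omega_le (G : Geometry) (x : stdSimplex ℝ A) : omega G x ≤ cOmega3 G (Fintype.card A) := by
  cases G with
  | euclidean =>
    simp only [omega, cOmega3]
    linarith [sum_sq_le_one x]
  | nonEuclidean =>
    simp only [omega, cOmega3]
    have : ∑ a, x a * Real.log (x a) ≤ 0 := Finset.sum_nonpos fun a _ =>
      Real.mul_log_nonpos (stdSimplex.zero_le x a) (stdSimplex.le_one x a)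
    linarith

omit [Nonempty A] in
theorem bregman_euclidean_le (x y : stdSimplex ℝ A) : bregman .euclidean x y ≤ 1 := by
  rw [bregman_euclidean]
  have : ∑ a, (x a - y a) ^ 2 ≤ ∑ a, x a ^ 2 + ∑ a, y a ^ 2 := by
    rw [← Finset.sum_add_distrib]
    refine Finset.sum_le_sum fun a _ => ?_
    have := mul_nonneg (stdSimplex.zero_le x a) (stdSimplex.zero_le y a)
    nlinarith
  linarith [sum_sq_le_one x, sum_sq_le_one y]

theorem bregman_barycenter_le (G : Geometry) (x : stdSimplex ℝ A) :
    bregman G x stdSimplex.barycenter ≤ cOmega3 G (Fintype.card A) := by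
  cases G with
  | euclidean => exact bregman_euclidean_le _ _
  | nonEuclidean => rw [← omega_nonEuclidean_eq_bregman]; exact omega_le _ _

/-- The oscillation of `lam ∇ω(p)` is at most `R` (in the non-euclidean geometry). -/
def LogOscLe (G : Geometry) (lam R : ℝ) (p : stdSimplex ℝ A) : Prop :=
  G = .nonEuclidean → ∀ a b, lam * (Real.log (p a) - Real.log (p b)) ≤ R

theorem exists_inv_card_le (p : stdSimplex ℝ A) :
    ∃ b, (Fintype.card A : ℝ)⁻¹ ≤ p b := by
  by_contra h
  push Not at h
  have := Finset.sum_lt_sum_of_nonempty Finset.univ_nonempty fun a (_ : a ∈ Finset.univ) => h a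
  rw [stdSimplex.sum_eq_one] at this
  simp at this

/-- Some coordinate of p is at least 1/|A|, and bounded oscillation of λ log p carries this to a
lower bound at every coordinate. The lemma limits the loss at states that were not visited. -/
theorem mul_bregman_le (G : Geometry) {lam R : ℝ} (hlam : 0 ≤ lam) (x p : stdSimplex ℝ A)
    (hp : IsInterior G p) (hR : 0 ≤ R) (hosc : LogOscLe G lam R p) :
    lam * bregman G x p ≤ lam * cOmega3 G (Fintype.card A) + R := by
  cases G with
  | euclidean =>
    have := mul_le_mul_of_nonneg_left (bregman_euclidean_le x p) hlam
    simp only [cOmega3]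
    linarith
  | nonEuclidean =>
    replace hp := hp rfl
    obtain ⟨b, hb⟩ := exists_inv_card_le p
    have hb' : -Real.log (Fintype.card A) ≤ Real.log (p b) := by
      rw [← Real.log_inv]
      exact Real.log_le_log (inv_pos.2 (by exact_mod_cast Fintype.card_pos)) hb
    rw [bregman_nonEuclidean, Finset.mul_sum]
    simp only [cOmega3]
    calc ∑ a, lam * (x a * (Real.log (x a) - Real.log (p a)))
        ≤ ∑ a, x a * (lam * Real.log (Fintype.card A) + R) := by
          refine Finset.sum_le_sum fun a _ => ?_
          have h1 := Real.mul_log_nonpos (stdSimplex.zero_le x a) (stdSimplex.le_one x a)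
          have h2 := mul_le_mul_of_nonneg_left (hosc rfl b a) (stdSimplex.zero_le x a)
          have h3 := mul_le_mul_of_nonneg_left hb' (mul_nonneg (stdSimplex.zero_le x a) hlam)
          have h4 := mul_nonpos_of_nonneg_of_nonpos hlam h1
          linarith
      _ = _ := by rw [← Finset.sum_mul, stdSimplex.sum_eq_one, one_mul]

/-- Up to a constant, λ log of the new point is (1 - λt) · λ log p + λt · (-q). For λt ≤ 1 this is a
convex combination of two vectors of oscillation at most R. -/
theorem LogOscLe.policyUpdate {G : Geometry} {lam R t : ℝ} {p : stdSimplex ℝ A}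
    (hlam : 0 ≤ lam) (ht : 0 ≤ t) (hlt : lam * t ≤ 1) (hp : IsInterior G p)
    (hosc : LogOscLe G lam R p) {q : A → ℝ} (hq0 : ∀ a, 0 ≤ q a) (hq : ∀ a, q a ≤ R) :
    LogOscLe G lam R (policyUpdate G lam t p q) := by
  rintro rfl a b
  rw [log_policyUpdate lam t p q (hp rfl), log_policyUpdate lam t p q (hp rfl)]
  simp only [gradOmega]
  have h1 := mul_le_mul_of_nonneg_left (hosc rfl a b) (sub_nonneg.2 hlt)
  have h2 : q b - q a ≤ R := by linarith [hq0 a, hq b]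
  have h3 := mul_le_mul_of_nonneg_left h2 (mul_nonneg hlam ht)
  linarith

omit [Nonempty A] in
/-- Bound on the dual norm of `q + lam ∇ω(p)` in terms of a bound `B` on `q`. -/
theorem dualBound_grad (G : Geometry) {lam B R : ℝ} (hlam : 0 ≤ lam) (p : stdSimplex ℝ A)
    (q : A → ℝ) (hq0 : ∀ a, 0 ≤ q a) (hq : ∀ a, q a ≤ B) (hlamB : lam ≤ B ∨ G = .nonEuclidean)
    (hosc : LogOscLe G lam R p) :
    DualBound G (fun a => q a + lam * gradOmega G p a)
      (match G with
      | .euclidean => 4 * Fintype.card A * B ^ 2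
      | .nonEuclidean => (B + R) ^ 2) := by
  cases G with
  | euclidean =>
    simp only [DualBound, gradOmega]
    have hlamB : lam ≤ B := by simpa using hlamB
    calc ∑ a, (q a + lam * p a) ^ 2 ≤ ∑ _a : A, (2 * B) ^ 2 := by
          refine Finset.sum_le_sum fun a _ => ?_
          have h0 := mul_nonneg hlam (stdSimplex.zero_le p a)
          have h1 := mul_le_mul_of_nonneg_left (stdSimplex.le_one p a) hlam
          exact pow_le_pow_left₀ (by linarith [hq0 a]) (by linarith [hq a]) 2
      _ = 4 * Fintype.card A * B ^ 2 := by simp; ring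
  | nonEuclidean =>
    intro a b
    simp only [gradOmega]
    have h1 := hosc rfl a b
    have h2 := hosc rfl b a
    refine sq_le_sq' ?_ ?_
    · linarith [hq0 a, hq b]
    · linarith [hq0 b, hq a]

end OmegaBounds

/-! ### Values, visitation frequencies and the performance difference identity. -/

section Values

variable {S A : Type*} [Fintype S] [DecidableEq S] [Fintype A]
variable (𝓜 : MDP S A) (G : Geometry) (lam : ℝ)

omit [DecidableEq S] in
theorem transition_nonneg (π : Policy S A) (s s' : S) : 0 ≤ transition 𝓜 π s s' :=
  Finset.sum_nonneg fun a _ => mul_nonneg (stdSimplex.zero_le _ a) (stdSimplex.zero_le _ _)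

omit [DecidableEq S] in
theorem sum_transition (π : Policy S A) (s : S) : ∑ s', transition 𝓜 π s s' = 1 := by
  simp only [transition, Matrix.of_apply]
  rw [Finset.sum_comm]
  simp_rw [← Finset.mul_sum, stdSimplex.sum_eq_one, mul_one, stdSimplex.sum_eq_one]

/-- Strict row diagonal dominance: 1 - γP_kk > γ(1 - P_kk). -/
theorem isUnit_det_one_sub (π : Policy S A) : IsUnit (1 - 𝓜.γ • transition 𝓜 π).det := by
  rw [isUnit_iff_ne_zero]
  refine det_ne_zero_of_sum_row_lt_diag fun k => ?_
  have h1 : ∑ j ∈ Finset.univ.erase k, ‖(1 - 𝓜.γ • transition 𝓜 π) k j‖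
      = ∑ j ∈ Finset.univ.erase k, 𝓜.γ * transition 𝓜 π k j := by
    refine Finset.sum_congr rfl fun j hj => ?_
    rw [Matrix.sub_apply, Matrix.one_apply_ne (Finset.ne_of_mem_erase hj).symm, zero_sub, norm_neg,
      Matrix.smul_apply, smul_eq_mul, Real.norm_of_nonneg
        (mul_nonneg 𝓜.γ_pos.le (transition_nonneg 𝓜 π k j))]
  have h2 := Finset.add_sum_erase Finset.univ (fun j => transition 𝓜 π k j) (Finset.mem_univ k)
  rw [sum_transition] at h2
  rw [h1, ← Finset.mul_sum, Matrix.sub_apply, Matrix.one_apply_eq, Matrix.smul_apply, smul_eq_mul]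
  refine lt_of_lt_of_le ?_ (le_abs_self _)
  have : ∑ j ∈ Finset.univ.erase k, transition 𝓜 π k j = 1 - transition 𝓜 π k k := by linarith
  rw [this]
  linarith [𝓜.γ_lt_one]

theorem resolvent_mulVec (π : Policy S A) (c : S → ℝ) (s : S) :
    ((1 - 𝓜.γ • transition 𝓜 π)⁻¹.mulVec c) s = c s +
      𝓜.γ * ∑ s', transition 𝓜 π s s' * ((1 - 𝓜.γ • transition 𝓜 π)⁻¹.mulVec c) s' := by
  set v := (1 - 𝓜.γ • transition 𝓜 π)⁻¹.mulVec c with hv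
  have h : (1 - 𝓜.γ • transition 𝓜 π).mulVec v = c := by
    rw [hv, Matrix.mulVec_mulVec, Matrix.mul_nonsing_inv _ (isUnit_det_one_sub 𝓜 π),
      Matrix.one_mulVec]
  have h' := congrFun h s
  rw [Matrix.sub_mulVec, Matrix.one_mulVec, Matrix.smul_mulVec] at h'
  simp only [Pi.sub_apply, Pi.smul_apply, smul_eq_mul, Matrix.mulVec, dotProduct] at h'
  linarith

omit [DecidableEq S] in
-- Minimum principle: where v is smallest, its average over successors is no smaller, so (1-γ)v ≥ c
-- ≥ 0 there. Applied to `valueBound` minus the value, it also yields the upper bound on values.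
theorem nonneg_of_bellman (π : Policy S A) (c v : S → ℝ)
    (hv : ∀ s, v s = c s + 𝓜.γ * ∑ s', transition 𝓜 π s s' * v s') (hc : ∀ s, 0 ≤ c s) (s : S) :
    0 ≤ v s := by
  obtain ⟨m, -, hm⟩ := Finset.exists_min_image Finset.univ v ⟨s, Finset.mem_univ s⟩
  refine le_trans ?_ (hm s (Finset.mem_univ s))
  have h1 : v m ≤ ∑ s', transition 𝓜 π m s' * v s' := by
    calc v m = ∑ s', transition 𝓜 π m s' * v m := by
          rw [← Finset.sum_mul, sum_transition, one_mul]
      _ ≤ _ := Finset.sum_le_sum fun s' _ =>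
          mul_le_mul_of_nonneg_left (hm s' (Finset.mem_univ s')) (transition_nonneg 𝓜 π m s')
  have h2 := hv m
  have h3 := mul_le_mul_of_nonneg_left h1 𝓜.γ_pos.le
  have h4 : 0 ≤ (1 - 𝓜.γ) * v m := by linarith [hc m]
  exact nonneg_of_mul_nonneg_right h4 (sub_pos.2 𝓜.γ_lt_one)

theorem resolvent_mulVec_nonneg (π : Policy S A) (c : S → ℝ) (hc : ∀ s, 0 ≤ c s) (s : S) :
    0 ≤ ((1 - 𝓜.γ • transition 𝓜 π)⁻¹.mulVec c) s :=
  nonneg_of_bellman 𝓜 π c _ (resolvent_mulVec 𝓜 π c) hc s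

theorem sum_visitation_mul (μ : stdSimplex ℝ S) (π : Policy S A) (c : S → ℝ) :
    ∑ s, visitation 𝓜 μ π s * c s =
      (1 - 𝓜.γ) * ∑ s, μ s * ((1 - 𝓜.γ • transition 𝓜 π)⁻¹.mulVec c) s := by
  have := Matrix.dotProduct_mulVec (μ : S → ℝ) (1 - 𝓜.γ • transition 𝓜 π)⁻¹ c
  simp only [dotProduct] at this
  rw [this, Finset.mul_sum]
  refine Finset.sum_congr rfl fun s _ => ?_
  simp only [visitation, Pi.smul_apply, smul_eq_mul]
  ring

theorem visitation_nonneg (μ : stdSimplex ℝ S) (π : Policy S A) (s : S) :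
    0 ≤ visitation 𝓜 μ π s := by
  have h := sum_visitation_mul 𝓜 μ π (Pi.single s 1)
  rw [Finset.sum_eq_single s (fun b _ hb => by simp [hb]) (by simp)] at h
  simp only [Pi.single_eq_same, mul_one] at h
  rw [h]
  refine mul_nonneg (sub_nonneg.2 𝓜.γ_lt_one.le) (Finset.sum_nonneg fun s' _ =>
    mul_nonneg (stdSimplex.zero_le μ s') (resolvent_mulVec_nonneg 𝓜 π _ (fun s'' => ?_) s'))
  by_cases h : s'' = s
  · subst h; simp
  · simp [h]

theorem sum_visitation (μ : stdSimplex ℝ S) (π : Policy S A) : ∑ s, visitation 𝓜 μ π s = 1 := by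
  have h := sum_visitation_mul 𝓜 μ π (fun _ => 1)
  have h1 : ∀ s, ((1 - 𝓜.γ • transition 𝓜 π)⁻¹.mulVec fun _ => 1) s = (1 - 𝓜.γ)⁻¹ := by
    have hne : (1 - 𝓜.γ) ≠ 0 := (sub_pos.2 𝓜.γ_lt_one).ne'
    have h2 : (1 - 𝓜.γ • transition 𝓜 π).mulVec (fun _ => (1 - 𝓜.γ)⁻¹) = fun _ => 1 := by
      ext s
      rw [Matrix.sub_mulVec, Matrix.one_mulVec, Matrix.smul_mulVec]
      simp only [Pi.sub_apply, Pi.smul_apply, smul_eq_mul, Matrix.mulVec, dotProduct]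
      rw [← Finset.sum_mul, sum_transition]
      field_simp
    intro s
    rw [← h2, Matrix.mulVec_mulVec, Matrix.nonsing_inv_mul _ (isUnit_det_one_sub 𝓜 π),
      Matrix.one_mulVec]
  simp_rw [h1, mul_one, ← Finset.sum_mul, stdSimplex.sum_eq_one, one_mul] at h
  rw [h]
  exact mul_inv_cancel₀ (sub_pos.2 𝓜.γ_lt_one).ne'

theorem visitation_le (μ ν : stdSimplex ℝ S) (π : Policy S A)
    (h : concentrability 𝓜 μ ν π ≠ ⊤) (s : S) :
    visitation 𝓜 μ π s ≤ (concentrability 𝓜 μ ν π).toReal * ν s := by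
  have hle : ENNReal.ofReal (visitation 𝓜 μ π s) / ENNReal.ofReal (ν s) ≤
      concentrability 𝓜 μ ν π :=
    le_iSup (fun s => ENNReal.ofReal (visitation 𝓜 μ π s) / ENNReal.ofReal (ν s)) s
  rcases (stdSimplex.zero_le ν s).eq_or_lt with h0 | hpos
  · rw [← h0, ENNReal.ofReal_zero] at hle
    rw [← h0, mul_zero]
    by_contra hd
    push Not at hd
    rw [ENNReal.div_zero (ENNReal.ofReal_pos.2 hd).ne'] at hle
    exact h (top_le_iff.1 hle)
  · have := ENNReal.toReal_mono h hle
    rw [ENNReal.toReal_div, ENNReal.toReal_ofReal (visitation_nonneg 𝓜 μ π s),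
      ENNReal.toReal_ofReal hpos.le] at this
    exact (div_le_iff₀ hpos).1 this

theorem value_eq (π : Policy S A) (s : S) :
    value 𝓜 G lam π s = cost 𝓜 G lam π s +
      𝓜.γ * ∑ s', transition 𝓜 π s s' * value 𝓜 G lam π s' :=
  resolvent_mulVec 𝓜 π _ s

/-- The action value function `q_λ^π`. -/
def actionValue (π : Policy S A) (s : S) (a : A) : ℝ :=
  𝓜.c s a + lam * omega G (π s) + 𝓜.γ * ∑ s', 𝓜.P s a s' * value 𝓜 G lam π s'

/-- The Bellman gap `v_λ^π - T_λ^{π'} v_λ^π`. -/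
def bellmanGap (π π' : Policy S A) (s : S) : ℝ :=
  value 𝓜 G lam π s -
    (cost 𝓜 G lam π' s + 𝓜.γ * ∑ s', transition 𝓜 π' s s' * value 𝓜 G lam π s')

/-- The action value of π charges the regulariser of π even when averaged under π'. The resulting
difference of ω is what turns into a Bregman distance in `bellmanGap_eq`. -/
theorem sum_mul_actionValue (π π' : Policy S A) (s : S) :
    ∑ a, π' s a * actionValue 𝓜 G lam π s a = cost 𝓜 G lam π' s
      + lam * (omega G (π s) - omega G (π' s))
      + 𝓜.γ * ∑ s', transition 𝓜 π' s s' * value 𝓜 G lam π s' := by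
  simp only [actionValue, cost, mul_add, Finset.sum_add_distrib, transition, Matrix.of_apply]
  rw [← Finset.sum_mul, stdSimplex.sum_eq_one]
  have : ∑ a, π' s a * (𝓜.γ * ∑ s', 𝓜.P s a s' * value 𝓜 G lam π s') =
      𝓜.γ * ∑ s', (∑ a, π' s a * 𝓜.P s a s') * value 𝓜 G lam π s' := by
    simp only [Finset.mul_sum, Finset.sum_mul]
    rw [Finset.sum_comm]
    exact Finset.sum_congr rfl fun _ _ => Finset.sum_congr rfl fun _ _ => by ring
  rw [this]
  ring

theorem sum_mul_actionValue_self (π : Policy S A) (s : S) :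
    ∑ a, π s a * actionValue 𝓜 G lam π s a = value 𝓜 G lam π s := by
  rw [sum_mul_actionValue, value_eq 𝓜 G lam π s]
  ring

theorem bellmanGap_eq (π π' : Policy S A) (s : S) :
    bellmanGap 𝓜 G lam π π' s =
      ∑ a, (actionValue 𝓜 G lam π s a + lam * gradOmega G (π s) a) * (π s a - π' s a)
        - lam * bregman G (π' s) (π s) := by
  have h1 : ∑ a, (actionValue 𝓜 G lam π s a + lam * gradOmega G (π s) a) * (π s a - π' s a) =
      ∑ a, π s a * actionValue 𝓜 G lam π s a - ∑ a, π' s a * actionValue 𝓜 G lam π s a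
      - lam * ∑ a, gradOmega G (π s) a * (π' s a - π s a) := by
    simp only [Finset.mul_sum, ← Finset.sum_sub_distrib]
    exact Finset.sum_congr rfl fun _ _ => by ring
  rw [h1, sum_mul_actionValue_self, sum_mul_actionValue, bellmanGap, bregman]
  ring

/-- The gap is (I - γP^π')v^π - c^π', and pairing with d_{μ,π'} applies (1-γ)μ(I - γP^π')⁻¹, which
leaves v^π - v^π'. -/
theorem sum_visitation_mul_bellmanGap (μ : stdSimplex ℝ S) (π π' : Policy S A) :
    ∑ s, visitation 𝓜 μ π' s * bellmanGap 𝓜 G lam π π' s =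
      (1 - 𝓜.γ) * (scalarValue 𝓜 μ G lam π - scalarValue 𝓜 μ G lam π') := by
  have h : bellmanGap 𝓜 G lam π π' =
      (1 - 𝓜.γ • transition 𝓜 π').mulVec (value 𝓜 G lam π) - cost 𝓜 G lam π' := by
    ext s
    rw [Matrix.sub_mulVec, Matrix.one_mulVec, Matrix.smul_mulVec]
    simp only [bellmanGap, Pi.sub_apply, Pi.smul_apply, smul_eq_mul, Matrix.mulVec, dotProduct]
    ring
  rw [sum_visitation_mul, h, Matrix.mulVec_sub, Matrix.mulVec_mulVec,
    Matrix.nonsing_inv_mul _ (isUnit_det_one_sub 𝓜 π'), Matrix.one_mulVec]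
  simp only [Pi.sub_apply, mul_sub, Finset.sum_sub_distrib, scalarValue, value]

variable {lam} [Nonempty A]

/-- The largest regularized value `C_{max,λ} / (1 - γ)`. -/
def valueBound (lam : ℝ) : ℝ :=
  cMaxReg G (Fintype.card A) 𝓜.Cmax lam / (1 - 𝓜.γ)

omit [DecidableEq S] in
theorem stepCost_nonneg (hlam : 0 ≤ lam) (π : Policy S A) (s : S) (a : A) :
    0 ≤ 𝓜.c s a + lam * omega G (π s) :=
  add_nonneg (𝓜.c_nonneg s a) (mul_nonneg hlam (omega_nonneg G _))

omit [DecidableEq S] [Nonempty A] in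
theorem stepCost_le (hlam : 0 ≤ lam) (π : Policy S A) (s : S) (a : A) :
    𝓜.c s a + lam * omega G (π s) ≤ (1 - 𝓜.γ) * valueBound 𝓜 G lam := by
  rw [valueBound, mul_div_cancel₀ _ (sub_pos.2 𝓜.γ_lt_one).ne', cMaxReg_eq]
  exact add_le_add (𝓜.c_le s a) (mul_le_mul_of_nonneg_left (omega_le G _) hlam)

omit [DecidableEq S] [Nonempty A] in
theorem cost_eq_sum (π : Policy S A) (s : S) :
    cost 𝓜 G lam π s = ∑ a, π s a * (𝓜.c s a + lam * omega G (π s)) := by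
  simp only [cost, mul_add, Finset.sum_add_distrib, ← Finset.sum_mul, stdSimplex.sum_eq_one,
    one_mul]

omit [DecidableEq S] in
theorem cost_nonneg (hlam : 0 ≤ lam) (π : Policy S A) (s : S) : 0 ≤ cost 𝓜 G lam π s := by
  rw [cost_eq_sum]
  exact Finset.sum_nonneg fun a _ =>
    mul_nonneg (stdSimplex.zero_le _ a) (stepCost_nonneg 𝓜 G hlam π s a)

omit [DecidableEq S] [Nonempty A] in
theorem cost_le (hlam : 0 ≤ lam) (π : Policy S A) (s : S) :
    cost 𝓜 G lam π s ≤ (1 - 𝓜.γ) * valueBound 𝓜 G lam := by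
  rw [cost_eq_sum]
  calc _ ≤ ∑ a, π s a * ((1 - 𝓜.γ) * valueBound 𝓜 G lam) := Finset.sum_le_sum fun a _ =>
        mul_le_mul_of_nonneg_left (stepCost_le 𝓜 G hlam π s a) (stdSimplex.zero_le _ a)
    _ = _ := by rw [← Finset.sum_mul, stdSimplex.sum_eq_one, one_mul]

theorem value_nonneg (hlam : 0 ≤ lam) (π : Policy S A) (s : S) : 0 ≤ value 𝓜 G lam π s :=
  nonneg_of_bellman 𝓜 π _ _ (value_eq 𝓜 G lam π) (cost_nonneg 𝓜 G hlam π) s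

omit [Nonempty A] in
theorem value_le (hlam : 0 ≤ lam) (π : Policy S A) (s : S) :
    value 𝓜 G lam π s ≤ valueBound 𝓜 G lam := by
  have := nonneg_of_bellman 𝓜 π (fun s => (1 - 𝓜.γ) * valueBound 𝓜 G lam - cost 𝓜 G lam π s)
    (fun s => valueBound 𝓜 G lam - value 𝓜 G lam π s) (fun s => by
      simp only [mul_sub, Finset.sum_sub_distrib, ← Finset.sum_mul, sum_transition]
      have := value_eq 𝓜 G lam π s
      linarith) (fun s => sub_nonneg.2 (cost_le 𝓜 G hlam π s)) s
  linarith

theorem actionValue_nonneg (hlam : 0 ≤ lam) (π : Policy S A) (s : S) (a : A) :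
    0 ≤ actionValue 𝓜 G lam π s a :=
  add_nonneg (stepCost_nonneg 𝓜 G hlam π s a) (mul_nonneg 𝓜.γ_pos.le
    (Finset.sum_nonneg fun s' _ => mul_nonneg (stdSimplex.zero_le _ s')
      (value_nonneg 𝓜 G hlam π s')))

omit [Nonempty A] in
theorem actionValue_le (hlam : 0 ≤ lam) (π : Policy S A) (s : S) (a : A) :
    actionValue 𝓜 G lam π s a ≤ valueBound 𝓜 G lam := by
  have h1 := stepCost_le 𝓜 G hlam π s a
  have h2 : ∑ s', 𝓜.P s a s' * value 𝓜 G lam π s' ≤ valueBound 𝓜 G lam := by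
    calc _ ≤ ∑ s', 𝓜.P s a s' * valueBound 𝓜 G lam := Finset.sum_le_sum fun s' _ =>
          mul_le_mul_of_nonneg_left (value_le 𝓜 G hlam π s') (stdSimplex.zero_le _ s')
      _ = _ := by rw [← Finset.sum_mul, stdSimplex.sum_eq_one, one_mul]
  have h3 := mul_le_mul_of_nonneg_left h2 𝓜.γ_pos.le
  rw [actionValue]
  linarith

theorem bellmanGap_le (hlam : 0 ≤ lam) (π π' : Policy S A) (s : S) :
    bellmanGap 𝓜 G lam π π' s ≤ valueBound 𝓜 G lam := by
  have h1 := value_le 𝓜 G hlam π s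
  have h2 := cost_nonneg 𝓜 G hlam π' s
  have h3 := mul_nonneg 𝓜.γ_pos.le (Finset.sum_nonneg fun s' (_ : s' ∈ Finset.univ) =>
    mul_nonneg (transition_nonneg 𝓜 π' s s') (value_nonneg 𝓜 G hlam π s'))
  rw [bellmanGap]
  linarith

variable (lam) in
/-- The expected cost of the rollout truncated after `T` steps. -/
def truncatedValue (π : Policy S A) : ℕ → S → A → ℝ
  | 0, _, _ => 0
  | T + 1, s, a => 𝓜.c s a + lam * omega G (π s) +
      𝓜.γ * ∑ s', 𝓜.P s a s' * ∑ a', π s' a' * truncatedValue π T s' a'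

theorem abs_sum_mul_le {ι : Type*} [Fintype ι] (x : stdSimplex ℝ ι) {u : ι → ℝ} {e : ℝ}
    (hu : ∀ i, |u i| ≤ e) : |∑ i, x i * u i| ≤ e := by
  simpa only [mul_comm] using abs_sum_mul_simplex_le hu x

/-- The discarded tail is γ^T times an expected action value after T steps. -/
theorem abs_truncatedValue_sub_le (hlam : 0 ≤ lam) (π : Policy S A) (T : ℕ) (s : S) (a : A) :
    |truncatedValue 𝓜 G lam π T s a - actionValue 𝓜 G lam π s a| ≤
      𝓜.γ ^ T * valueBound 𝓜 G lam := by
  induction T generalizing s a with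
  | zero =>
    rw [truncatedValue, zero_sub, abs_neg, abs_of_nonneg (actionValue_nonneg 𝓜 G hlam π s a),
      pow_zero, one_mul]
    exact actionValue_le 𝓜 G hlam π s a
  | succ T ih =>
    have : truncatedValue 𝓜 G lam π (T + 1) s a - actionValue 𝓜 G lam π s a =
        𝓜.γ * ∑ s', 𝓜.P s a s' *
          ∑ a', π s' a' * (truncatedValue 𝓜 G lam π T s' a' - actionValue 𝓜 G lam π s' a') := by
      simp only [mul_sub, Finset.sum_sub_distrib, sum_mul_actionValue_self]
      rw [truncatedValue, actionValue]
      ring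
    rw [this, abs_mul, abs_of_pos 𝓜.γ_pos, pow_succ', mul_assoc]
    exact mul_le_mul_of_nonneg_left
      (abs_sum_mul_le _ fun s' => abs_sum_mul_le _ fun a' => ih s' a') 𝓜.γ_pos.le

end Values

/-! ### Means under discrete laws. -/

section Mean

variable {α β : Type*}

/-- `f` has mean `m` under the probability mass function `p`. -/
def HasMean (p : PMF α) (f : α → ℝ) (m : ℝ) : Prop :=
  HasSum (fun a => (p a).toReal * f a) m

theorem hasMean_const (p : PMF α) (c : ℝ) : HasMean p (fun _ => c) c := by
  have h : HasSum (fun a => (p a).toReal) 1 := by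
    have := ENNReal.hasSum_toReal (f := p) (by rw [p.tsum_coe]; exact ENNReal.one_ne_top)
    rw [← ENNReal.tsum_toReal_eq (fun a => p.apply_ne_top a), p.tsum_coe] at this
    simpa using this
  simpa [HasMean] using h.mul_right c

theorem HasMean.add {p : PMF α} {f g : α → ℝ} {m n : ℝ} (hf : HasMean p f m) (hg : HasMean p g n) :
    HasMean p (fun a => f a + g a) (m + n) := by
  simpa only [HasMean, mul_add] using HasSum.add hf hg

theorem HasMean.const_mul {p : PMF α} {f : α → ℝ} {m : ℝ} (c : ℝ) (hf : HasMean p f m) :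
    HasMean p (fun a => c * f a) (c * m) := by
  simpa only [HasMean, mul_left_comm] using HasSum.mul_left c hf

theorem hasMean_pure (a : α) (f : α → ℝ) : HasMean (PMF.pure a) f (f a) := by
  have := hasSum_single (f := fun b => (PMF.pure a b).toReal * f b) a (fun b hb => by
    simp [PMF.pure_apply, hb])
  simpa [HasMean] using this

theorem HasMean.bind [Fintype α] {p : PMF α} {g : α → PMF β} {f : β → ℝ} {m : α → ℝ}
    (h : ∀ a, HasMean (g a) f (m a)) : HasMean (p.bind g) f (∑ a, (p a).toReal * m a) := by
  have : (fun b => ((p.bind g) b).toReal * f b) =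
      fun b => ∑ a, (p a).toReal * ((g a b).toReal * f b) := by
    ext b
    rw [PMF.bind_apply, tsum_fintype, ENNReal.toReal_sum (fun a _ =>
      ENNReal.mul_ne_top (p.apply_ne_top a) ((g a).apply_ne_top b)), Finset.sum_mul]
    exact Finset.sum_congr rfl fun a _ => by rw [ENNReal.toReal_mul, mul_assoc]
  rw [HasMean, this]
  exact hasSum_sum fun a _ => (h a).mul_left _

/-- Injectivity makes this a mere reindexing of the sum; the rollout maps r ↦ c + γr satisfy it as γ
> 0. -/
theorem HasMean.map {p : PMF α} {g : α → β} (hg : Function.Injective g) {f : β → ℝ} {m : ℝ}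
    (h : HasMean p (fun a => f (g a)) m) : HasMean (p.map g) f m := by
  rw [HasMean, ← hg.hasSum_iff]
  · have hpg : ∀ a, (p.map g) (g a) = p a := fun a => by
      rw [PMF.map_apply, tsum_eq_single a fun a' ha' => if_neg fun he => ha' (hg he.symm),
        if_pos rfl]
    simpa only [Function.comp_def, hpg, HasMean] using h
  · intro b hb
    have : b ∉ (p.map g).support := by
      rw [PMF.mem_support_map_iff]
      rintro ⟨a, -, rfl⟩
      exact hb ⟨a, rfl⟩
    rw [PMF.mem_support_iff, not_not] at this
    simp [this]

theorem HasMean.nonneg {p : PMF α} {f : α → ℝ} {m : ℝ} (h : HasMean p f m)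
    (hf : ∀ a ∈ p.support, 0 ≤ f a) : 0 ≤ m := by
  refine HasSum.nonneg (fun a => ?_) h
  by_cases ha : a ∈ p.support
  · exact mul_nonneg ENNReal.toReal_nonneg (hf a ha)
  · rw [PMF.mem_support_iff, not_not] at ha
    simp [ha]

end Mean

/-! ### Independent draws from a discrete law and Hoeffding's inequality. -/

section Hoeffding

variable {Z : Type*}

theorem tsum_pi_prod (g : Z → ℝ≥0∞) (M : ℕ) :
    ∑' b : Fin M → Z, ∏ m, g (b m) = (∑' z, g z) ^ M := by
  induction M with
  | zero => simp
  | succ M ih =>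
    rw [← (Fin.consEquiv fun _ => Z).tsum_eq, ENNReal.tsum_prod', pow_succ', ← ih,
      ← ENNReal.tsum_mul_right]
    refine tsum_congr fun z => ?_
    rw [← ENNReal.tsum_mul_left]
    refine tsum_congr fun b => ?_
    simp [Fin.consEquiv, Fin.prod_univ_succ]

/-- The probability that `M` independent draws from `p` lie in `E`. -/
def batchMass (p : PMF Z) (M : ℕ) (E : Set (Fin M → Z)) : ℝ≥0∞ :=
  ∑' b, E.indicator (fun b => ∏ m, p (b m)) b

theorem batchMass_mono (p : PMF Z) {M : ℕ} {E F : Set (Fin M → Z)} (h : E ⊆ F) :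
    batchMass p M E ≤ batchMass p M F :=
  ENNReal.tsum_le_tsum fun b => Set.indicator_le_indicator_of_subset h (fun _ => zero_le) b

theorem batchMass_union_le (p : PMF Z) {M : ℕ} (E F : Set (Fin M → Z)) :
    batchMass p M (E ∪ F) ≤ batchMass p M E + batchMass p M F := by
  rw [batchMass, batchMass, batchMass, ← ENNReal.tsum_add]
  refine ENNReal.tsum_le_tsum fun b => ?_
  by_cases h : b ∈ E
  · simp [h]
  · by_cases h' : b ∈ F <;> simp [h, h']

theorem batchMass_iUnion_le {ι : Type*} [Fintype ι] (p : PMF Z) {M : ℕ}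
    (E : ι → Set (Fin M → Z)) : batchMass p M (⋃ i, E i) ≤ ∑ i, batchMass p M (E i) := by
  simp only [batchMass]
  rw [← tsum_fintype (L := .unconditional _), ENNReal.tsum_comm]
  refine ENNReal.tsum_le_tsum fun b => ?_
  by_cases h : b ∈ ⋃ i, E i
  · obtain ⟨i, hi⟩ := Set.mem_iUnion.1 h
    rw [Set.indicator_of_mem h]
    refine le_trans ?_ (ENNReal.le_tsum i)
    rw [Set.indicator_of_mem hi]
  · simp [h]

theorem batchMass_not_support (p : PMF Z) (M : ℕ) :
    batchMass p M {b | ∃ m, b m ∉ p.support} = 0 := by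
  refine ENNReal.tsum_eq_zero.2 fun b => ?_
  by_cases h : ∃ m, b m ∉ p.support
  · rw [Set.indicator_of_mem (by exact h)]
    obtain ⟨m, hm⟩ := h
    rw [PMF.mem_support_iff, not_not] at hm
    exact Finset.prod_eq_zero (Finset.mem_univ m) hm
  · exact Set.indicator_of_notMem (by exact h) _

/-- The affine majorant of the exponential has mean exp(R²/2), because f is centred. -/
theorem tsum_mul_exp_le (p : PMF Z) (f : Z → ℝ) (hf : HasMean p f 0) {R : ℝ} (hR : 0 ≤ R)
    (hfR : ∀ z ∈ p.support, |f z| ≤ R) :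
    ∑' z, p z * ENNReal.ofReal (Real.exp (f z)) ≤ ENNReal.ofReal (Real.exp (R ^ 2 / 2)) := by
  obtain ⟨c, hc⟩ := exists_exp_le_affine hR
  have hmean : HasSum (fun z => (p z).toReal * (Real.exp (R ^ 2 / 2) + c * f z))
      (Real.exp (R ^ 2 / 2) + c * 0) := (hasMean_const p _).add (hf.const_mul c)
  rw [mul_zero, add_zero] at hmean
  have hle : ∀ z, (p z).toReal * Real.exp (f z) ≤
      (p z).toReal * (Real.exp (R ^ 2 / 2) + c * f z) := by
    intro z
    by_cases hz : z ∈ p.support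
    · exact mul_le_mul_of_nonneg_left (hc _ (hfR z hz)) ENNReal.toReal_nonneg
    · rw [PMF.mem_support_iff, not_not] at hz
      simp [hz]
  rw [← hmean.tsum_eq, ENNReal.ofReal_tsum_of_nonneg
    (fun z => (mul_nonneg ENNReal.toReal_nonneg (Real.exp_nonneg _)).trans (hle z)) hmean.summable]
  refine ENNReal.tsum_le_tsum fun z => ?_
  refine le_trans (le_of_eq ?_) (ENNReal.ofReal_le_ofReal (hle z))
  rw [ENNReal.ofReal_mul ENNReal.toReal_nonneg, ENNReal.ofReal_toReal (p.apply_ne_top z)]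

theorem batchMass_hoeffding (p : PMF Z) (f : Z → ℝ) (hf : HasMean p f 0) {R ε : ℝ} (hR : 0 < R)
    (hε : 0 < ε) (hfR : ∀ z ∈ p.support, |f z| ≤ R) (M : ℕ) :
    batchMass p M {b | M * ε ≤ ∑ m, f (b m)} ≤
      ENNReal.ofReal (Real.exp (-(M * ε ^ 2 / (2 * R ^ 2)))) := by
  -- The minimiser of the Chernoff exponent -θMε + Mθ²R²/2.
  set θ := ε / R ^ 2 with hθ
  have hθ0 : 0 < θ := by positivity
  have hmgf := tsum_mul_exp_le p (fun z => θ * f z) (by simpa using hf.const_mul θ)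
    (R := θ * R) (by positivity) (fun z hz => by
      rw [abs_mul, abs_of_pos hθ0]
      exact mul_le_mul_of_nonneg_left (hfR z hz) hθ0.le)
  calc batchMass p M {b | M * ε ≤ ∑ m, f (b m)}
      ≤ ∑' b : Fin M → Z, ENNReal.ofReal (Real.exp (-(θ * (M * ε)))) *
          ∏ m, (p (b m) * ENNReal.ofReal (Real.exp (θ * f (b m)))) := by
        refine ENNReal.tsum_le_tsum fun b => ?_
        by_cases h : M * ε ≤ ∑ m, f (b m)
        · rw [Set.indicator_of_mem (by exact h), Finset.prod_mul_distrib, mul_left_comm]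
          refine le_mul_of_one_le_right' ?_
          rw [← ENNReal.ofReal_prod_of_nonneg (fun _ _ => Real.exp_nonneg _), ← Real.exp_sum,
            ← ENNReal.ofReal_mul (Real.exp_nonneg _), ← Real.exp_add, ← Finset.mul_sum,
            ENNReal.one_le_ofReal, Real.one_le_exp_iff]
          have := mul_le_mul_of_nonneg_left h hθ0.le
          linarith
        · rw [Set.indicator_of_notMem (by exact h)]
          exact zero_le
    _ ≤ ENNReal.ofReal (Real.exp (-(θ * (M * ε)))) *
          ENNReal.ofReal (Real.exp ((θ * R) ^ 2 / 2)) ^ M := by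
        rw [ENNReal.tsum_mul_left,
          tsum_pi_prod (fun z => p z * ENNReal.ofReal (Real.exp (θ * f z)))]
        gcongr
    _ = ENNReal.ofReal (Real.exp (-(M * ε ^ 2 / (2 * R ^ 2)))) := by
        rw [← ENNReal.ofReal_pow (Real.exp_nonneg _), ← Real.exp_nat_mul,
          ← ENNReal.ofReal_mul (Real.exp_nonneg _), ← Real.exp_add]
        congr 2
        rw [hθ]
        field_simp
        ring

end Hoeffding

/-! ### The law of one trajectory. -/

section Trajectories

variable {S A : Type*} [Fintype S] [Fintype A]

theorem toPMF_toReal {α : Type*} [Fintype α] (x : stdSimplex ℝ α) (a : α) :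
    (toPMF x a).toReal = x a := by
  rw [toPMF, PMF.ofFintype_apply, ENNReal.toReal_ofReal (stdSimplex.zero_le x a)]

variable (𝓜 : MDP S A) (G : Geometry) {lam : ℝ}

theorem hasMean_rollout (π : Policy S A) (T : ℕ) (s : S) (a : A) :
    HasMean (rollout 𝓜 G lam π T s a) (fun q => q) (truncatedValue 𝓜 G lam π T s a) := by
  induction T generalizing s a with
  | zero => exact hasMean_pure 0 _
  | succ T ih =>
    have h : HasMean (rollout 𝓜 G lam π (T + 1) s a) (fun q => q)
        (∑ s', (toPMF (𝓜.P s a) s').toReal * ∑ a', (toPMF (π s') a').toReal *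
          (𝓜.c s a + lam * omega G (π s) + 𝓜.γ * truncatedValue 𝓜 G lam π T s' a')) := by
      refine HasMean.bind fun s' => HasMean.bind fun a' => HasMean.map ?_ ?_
      · intro x y hxy
        exact mul_left_cancel₀ 𝓜.γ_pos.ne' (add_left_cancel hxy)
      · exact (hasMean_const _ _).add ((ih s' a').const_mul _)
    convert h using 1
    simp only [toPMF_toReal, mul_add, Finset.sum_add_distrib, ← Finset.sum_mul,
      stdSimplex.sum_eq_one, one_mul, truncatedValue, Finset.mul_sum]
    simp only [mul_left_comm]

theorem mem_support_rollout [Nonempty A] (hlam : 0 ≤ lam) (π : Policy S A) (T : ℕ) (s : S) (a : A)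
    {r : ℝ} (hr : r ∈ (rollout 𝓜 G lam π T s a).support) :
    0 ≤ r ∧ r ≤ valueBound 𝓜 G lam := by
  have hB : 0 ≤ valueBound 𝓜 G lam :=
    nonneg_of_mul_nonneg_right ((stepCost_nonneg 𝓜 G hlam π s a).trans
      (stepCost_le 𝓜 G hlam π s a)) (sub_pos.2 𝓜.γ_lt_one)
  induction T generalizing s a r with
  | zero =>
    rw [rollout, PMF.mem_support_pure_iff] at hr
    subst hr
    exact ⟨le_rfl, hB⟩
  | succ T ih =>
    rw [rollout, PMF.mem_support_bind_iff] at hr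
    obtain ⟨s', -, hr⟩ := hr
    rw [PMF.mem_support_bind_iff] at hr
    obtain ⟨a', -, hr⟩ := hr
    rw [PMF.mem_support_map_iff] at hr
    obtain ⟨r', hr', rfl⟩ := hr
    obtain ⟨h0, h1⟩ := ih s' a' hr'
    have h2 := stepCost_nonneg 𝓜 G hlam π s a
    have h3 := stepCost_le 𝓜 G hlam π s a
    have h4 := mul_nonneg 𝓜.γ_pos.le h0
    have h5 := mul_le_mul_of_nonneg_left h1 𝓜.γ_pos.le
    exact ⟨by linarith, by linarith⟩

/-- The law of the accepted state `s_m`. -/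
def stateLaw (ν : stdSimplex ℝ S) (π : Policy S A) (T : ℕ) (s : S) : ℝ :=
  ∑ s₀, ν s₀ * (sampleState 𝓜 π T s₀ s).toReal

theorem stateLaw_nonneg (ν : stdSimplex ℝ S) (π : Policy S A) (T : ℕ) (s : S) :
    0 ≤ stateLaw 𝓜 ν π T s :=
  Finset.sum_nonneg fun s₀ _ => mul_nonneg (stdSimplex.zero_le ν s₀) ENNReal.toReal_nonneg

theorem sum_stateLaw (ν : stdSimplex ℝ S) (π : Policy S A) (T : ℕ) :
    ∑ s, stateLaw 𝓜 ν π T s = 1 := by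
  simp only [stateLaw]
  rw [Finset.sum_comm]
  simp_rw [← Finset.mul_sum]
  have : ∀ s₀, ∑ s, (sampleState 𝓜 π T s₀ s).toReal = 1 := fun s₀ => by
    have h := hasMean_const (sampleState 𝓜 π T s₀) 1
    simp only [HasMean, mul_one] at h
    exact (hasSum_fintype _).unique h
  simp_rw [this, mul_one, stdSimplex.sum_eq_one]

theorem one_sub_le_sampleState (π : Policy S A) (T : ℕ) (s : S) :
    1 - 𝓜.γ ≤ (sampleState 𝓜 π T s s).toReal := by
  cases T with
  | zero => simp [sampleState, 𝓜.γ_pos.le]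
  | succ T =>
    rw [← ENNReal.ofReal_le_iff_le_toReal (PMF.apply_ne_top _ _), sampleState, PMF.bind_apply]
    refine le_trans ?_ (ENNReal.le_tsum true)
    simp [acceptCoin]

/-- Only immediate acceptance of the restart state is counted. This crude bound holds for every
policy and truncation length. -/
theorem mul_le_stateLaw (ν : stdSimplex ℝ S) (π : Policy S A) (T : ℕ) (s : S) :
    (1 - 𝓜.γ) * ν s ≤ stateLaw 𝓜 ν π T s := by
  refine le_trans ?_ (Finset.single_le_sum
    (f := fun s₀ => ν s₀ * (sampleState 𝓜 π T s₀ s).toReal)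
    (fun s₀ _ => mul_nonneg (stdSimplex.zero_le ν s₀) ENNReal.toReal_nonneg) (Finset.mem_univ s))
  rw [mul_comm]
  exact mul_le_mul_of_nonneg_left (one_sub_le_sampleState 𝓜 π T s) (stdSimplex.zero_le ν s)

variable [Nonempty A]

theorem hasMean_trajectory (ν : stdSimplex ℝ S) (T : ℕ) (π : Policy S A) (f : S × A × ℝ → ℝ)
    (m : S → A → ℝ) (h : ∀ s a, HasMean (rollout 𝓜 G lam π T s a) (fun q => f (s, a, q)) (m s a)) :
    HasMean (trajectory 𝓜 ν G lam T π) f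
      (∑ s, stateLaw 𝓜 ν π T s * ((Fintype.card A : ℝ)⁻¹ * ∑ a, m s a)) := by
  have h1 : HasMean (trajectory 𝓜 ν G lam T π) f
      (∑ s₀, (toPMF ν s₀).toReal * ∑ s, (sampleState 𝓜 π T s₀ s).toReal *
        ∑ a, (PMF.uniformOfFintype A a).toReal * m s a) :=
    HasMean.bind fun s₀ => HasMean.bind fun s => HasMean.bind fun a =>
      HasMean.map (fun x y hxy => by simpa using hxy) (h s a)
  convert h1 using 1
  simp only [toPMF_toReal, PMF.uniformOfFintype_apply, ENNReal.toReal_inv, ENNReal.toReal_natCast,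
    ← Finset.mul_sum, stateLaw, Finset.sum_mul]
  rw [Finset.sum_comm]
  refine Finset.sum_congr rfl fun s₀ _ => ?_
  rw [Finset.mul_sum]
  exact Finset.sum_congr rfl fun s _ => by ring

theorem mem_support_trajectory (hlam : 0 ≤ lam) (ν : stdSimplex ℝ S) (T : ℕ) (π : Policy S A)
    {z : S × A × ℝ} (hz : z ∈ (trajectory 𝓜 ν G lam T π).support) :
    0 ≤ z.2.2 ∧ z.2.2 ≤ valueBound 𝓜 G lam := by
  rw [trajectory, PMF.mem_support_bind_iff] at hz
  obtain ⟨s₀, -, hz⟩ := hz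
  rw [PMF.mem_support_bind_iff] at hz
  obtain ⟨s, -, hz⟩ := hz
  rw [PMF.mem_support_bind_iff] at hz
  obtain ⟨a, -, hz⟩ := hz
  rw [PMF.mem_support_map_iff] at hz
  obtain ⟨q, hq, rfl⟩ := hz
  exact mem_support_rollout 𝓜 G hlam π T s a hq

end Trajectories

/-! ### Concentration for one batch and the averaged estimation error. -/

section GoodBatch

variable {S A : Type*} [Fintype S] [DecidableEq S] [Fintype A] [DecidableEq A] [Nonempty A]
variable (𝓜 : MDP S A) (G : Geometry) (lam : ℝ) (ν : stdSimplex ℝ S) (T : ℕ) (π : Policy S A)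

/-- The largest value `|A| C_{max,λ} / (1 - γ)` of an importance weighted rollout. -/
def weightedBound : ℝ :=
  Fintype.card A * valueBound 𝓜 G lam

/-- Signed deviation of an importance weighted rollout from its mean, for the actions `α`. -/
def rolloutDeviation (α : S → A) (σ : S → Bool) (z : S × A × ℝ) : ℝ :=
  (if σ z.1 then 1 else -1) *
    (Fintype.card A * (if z.2.1 = α z.1 then z.2.2 else 0) -
      truncatedValue 𝓜 G lam π T z.1 (α z.1))

/-- Deviation of the indicator of a set of states from its mean, scaled to the size of a rollout. -/
def stateDeviation (σ : S → Bool) (z : S × A × ℝ) : ℝ :=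
  weightedBound 𝓜 G lam *
    ((∑ s, if σ s then stateLaw 𝓜 ν π T s else 0) - if σ z.1 then 1 else 0)

/-- Batches of samples for which all empirical deviations are smaller than `ε`. -/
structure GoodBatch (ε : ℝ) {M : ℕ} (b : Fin M → S × A × ℝ) : Prop where
  reward_nonneg : ∀ m, 0 ≤ (b m).2.2
  reward_le : ∀ m, (b m).2.2 ≤ valueBound 𝓜 G lam
  rollout_lt : ∀ α σ, ∑ m, rolloutDeviation 𝓜 G lam T π α σ (b m) < M * ε
  state_lt : ∀ σ, ∑ m, stateDeviation 𝓜 G lam ν T π σ (b m) < M * ε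

variable {lam}

omit [DecidableEq A] [DecidableEq S] in
theorem valueBound_nonneg [Nonempty S] (hlam : 0 ≤ lam) : 0 ≤ valueBound 𝓜 G lam := by
  obtain ⟨s⟩ := ‹Nonempty S›
  obtain ⟨a⟩ := ‹Nonempty A›
  have := (𝓜.c_nonneg s a).trans (𝓜.c_le s a)
  rw [valueBound, cMaxReg_eq]
  exact div_nonneg (add_nonneg this (mul_nonneg hlam (cOmega3_nonneg _ _)))
    (sub_nonneg.2 𝓜.γ_lt_one.le)

omit [DecidableEq A] [DecidableEq S] in
theorem valueBound_le_weightedBound [Nonempty S] (hlam : 0 ≤ lam) :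
    valueBound 𝓜 G lam ≤ weightedBound 𝓜 G lam :=
  le_mul_of_one_le_left (valueBound_nonneg 𝓜 G hlam) (by exact_mod_cast Fintype.card_pos)

omit [DecidableEq A] [DecidableEq S] in
theorem truncatedValue_nonneg (hlam : 0 ≤ lam) (s : S) (a : A) :
    0 ≤ truncatedValue 𝓜 G lam π T s a :=
  (hasMean_rollout 𝓜 G π T s a).nonneg fun _ hr => (mem_support_rollout 𝓜 G hlam π T s a hr).1

omit [DecidableEq A] [DecidableEq S] in
theorem truncatedValue_le (hlam : 0 ≤ lam) (s : S) (a : A) :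
    truncatedValue 𝓜 G lam π T s a ≤ valueBound 𝓜 G lam := by
  have h := ((hasMean_const _ (valueBound 𝓜 G lam)).add
    ((hasMean_rollout 𝓜 G (lam := lam) π T s a).const_mul (-1))).nonneg fun r hr => by
      linarith [(mem_support_rollout 𝓜 G hlam π T s a hr).2]
  linarith

omit [DecidableEq S] in
-- The deviation is centred already given the state: the weight |A| cancels the probability 1/|A| of
-- drawing the action α(s).
theorem hasMean_rolloutDeviation (α : S → A) (σ : S → Bool) :
    HasMean (trajectory 𝓜 ν G lam T π) (rolloutDeviation 𝓜 G lam T π α σ) 0 := by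
  have h := hasMean_trajectory 𝓜 G (lam := lam) ν T π (rolloutDeviation 𝓜 G lam T π α σ)
    (fun s a => (if σ s then 1 else -1) * (Fintype.card A *
      (if a = α s then truncatedValue 𝓜 G lam π T s a else 0)
        + -truncatedValue 𝓜 G lam π T s (α s))) (fun s a => by
      refine HasMean.const_mul _ (HasMean.add (HasMean.const_mul _ ?_) (hasMean_const _ _))
      by_cases h : a = α s
      · simpa only [h, if_true] using hasMean_rollout 𝓜 G π T s (α s)
      · simpa only [h, if_false] using hasMean_const _ 0)
  convert h using 1
  symm
  refine Finset.sum_eq_zero fun s _ => ?_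
  have hc : (Fintype.card A : ℝ) ≠ 0 := by exact_mod_cast Fintype.card_ne_zero
  have : ∑ a, (Fintype.card A * (if a = α s then truncatedValue 𝓜 G lam π T s a else 0)
      + -truncatedValue 𝓜 G lam π T s (α s)) = 0 := by
    rw [Finset.sum_add_distrib, ← Finset.mul_sum, Finset.sum_ite_eq']
    simp
  rw [← Finset.mul_sum, this]
  simp

omit [DecidableEq S] [DecidableEq A] in
theorem hasMean_stateDeviation (σ : S → Bool) :
    HasMean (trajectory 𝓜 ν G lam T π) (stateDeviation 𝓜 G lam ν T π σ) 0 := by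
  have h := hasMean_trajectory 𝓜 G (lam := lam) ν T π (stateDeviation 𝓜 G lam ν T π σ)
    (fun s a => weightedBound 𝓜 G lam *
      ((∑ s, if σ s then stateLaw 𝓜 ν π T s else 0) - if σ s then 1 else 0))
    (fun s a => hasMean_const _ _)
  convert h using 1
  have hc : (Fintype.card A : ℝ) ≠ 0 := by exact_mod_cast Fintype.card_ne_zero
  set pU := ∑ s, if σ s then stateLaw 𝓜 ν π T s else 0 with hpU
  have : ∀ s, stateLaw 𝓜 ν π T s * ((Fintype.card A : ℝ)⁻¹ * ∑ _a : A,
      weightedBound 𝓜 G lam * (pU - if σ s then 1 else 0)) =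
      weightedBound 𝓜 G lam * (stateLaw 𝓜 ν π T s * pU - if σ s then stateLaw 𝓜 ν π T s else 0) := by
    intro s
    rw [Finset.sum_const, Finset.card_univ, nsmul_eq_mul, inv_mul_cancel_left₀ hc]
    split_ifs <;> ring
  simp_rw [this]
  rw [← Finset.mul_sum, Finset.sum_sub_distrib, ← Finset.sum_mul, sum_stateLaw, ← hpU]
  ring

omit [DecidableEq S] in
theorem abs_rolloutDeviation_le (hlam : 0 ≤ lam) (α : S → A) (σ : S → Bool) {z : S × A × ℝ}
    (h0 : 0 ≤ z.2.2) (h1 : z.2.2 ≤ valueBound 𝓜 G lam) :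
    |rolloutDeviation 𝓜 G lam T π α σ z| ≤ weightedBound 𝓜 G lam := by
  have : Nonempty S := ⟨z.1⟩
  have hsign : |(if σ z.1 then (1 : ℝ) else -1)| = 1 := by split_ifs <;> simp
  have hB := valueBound_nonneg 𝓜 G hlam
  have ht0 := truncatedValue_nonneg 𝓜 G T π hlam z.1 (α z.1)
  have ht1 := (truncatedValue_le 𝓜 G T π hlam z.1 (α z.1)).trans
    (valueBound_le_weightedBound 𝓜 G hlam)
  have hq0 : 0 ≤ (if z.2.1 = α z.1 then z.2.2 else 0) := by split_ifs <;> simp [h0]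
  have hq1 : (if z.2.1 = α z.1 then z.2.2 else 0) ≤ valueBound 𝓜 G lam := by
    split_ifs <;> assumption
  have hA : (0 : ℝ) ≤ Fintype.card A := Nat.cast_nonneg _
  have h2 := mul_nonneg hA hq0
  have h3 : _ ≤ weightedBound 𝓜 G lam := mul_le_mul_of_nonneg_left hq1 hA
  rw [rolloutDeviation, abs_mul, hsign, one_mul, abs_le]
  exact ⟨by linarith, by linarith⟩

omit [DecidableEq S] [DecidableEq A] in
theorem abs_stateDeviation_le (hlam : 0 ≤ lam) (σ : S → Bool) (z : S × A × ℝ) :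
    |stateDeviation 𝓜 G lam ν T π σ z| ≤ weightedBound 𝓜 G lam := by
  have : Nonempty S := ⟨z.1⟩
  have hR := (valueBound_nonneg 𝓜 G hlam).trans (valueBound_le_weightedBound 𝓜 G hlam)
  have h0 : 0 ≤ ∑ s, if σ s then stateLaw 𝓜 ν π T s else 0 :=
    Finset.sum_nonneg fun s _ => by split_ifs <;> simp [stateLaw_nonneg]
  have h1 : (∑ s, if σ s then stateLaw 𝓜 ν π T s else 0) ≤ 1 := by
    rw [← sum_stateLaw 𝓜 ν π T]
    exact Finset.sum_le_sum fun s _ => by split_ifs <;> simp [stateLaw_nonneg]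
  rw [stateDeviation, abs_mul, abs_of_nonneg hR]
  refine mul_le_of_le_one_right hR ?_
  rw [abs_le]
  split_ifs <;> constructor <;> linarith

/-- Hoeffding for each of the |A|^S · 2^S pairs (α, σ), with two inequalities per pair. Samples off
the support, where the reward bounds might fail, have mass zero. -/
theorem batchMass_not_goodBatch_le (hlam : 0 ≤ lam) (hR : 0 < weightedBound 𝓜 G lam) {ε : ℝ}
    (hε : 0 < ε) (M : ℕ) :
    batchMass (trajectory 𝓜 ν G lam T π) M {b | ¬ GoodBatch 𝓜 G lam ν T π ε b} ≤
      ENNReal.ofReal (2 * (2 * Fintype.card A) ^ Fintype.card S *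
        Real.exp (-(M * ε ^ 2 / (2 * weightedBound 𝓜 G lam ^ 2)))) := by
  set p := trajectory 𝓜 ν G lam T π
  set E := Real.exp (-(M * ε ^ 2 / (2 * weightedBound 𝓜 G lam ^ 2)))
  have hsub : {b : Fin M → S × A × ℝ | ¬ GoodBatch 𝓜 G lam ν T π ε b} ⊆
      {b | ∃ m, b m ∉ p.support} ∪
        ⋃ i : (S → A) × (S → Bool), ({b | M * ε ≤ ∑ m, rolloutDeviation 𝓜 G lam T π i.1 i.2 (b m)} ∪
          {b | M * ε ≤ ∑ m, stateDeviation 𝓜 G lam ν T π i.2 (b m)}) := by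
    intro b hb
    by_contra hcon
    simp only [Set.mem_union, Set.mem_iUnion, Set.mem_ofPred_eq, not_or, not_exists, not_not,
      not_le] at hcon
    obtain ⟨h1, h2⟩ := hcon
    exact hb ⟨fun m => (mem_support_trajectory 𝓜 G hlam ν T π (h1 m)).1,
      fun m => (mem_support_trajectory 𝓜 G hlam ν T π (h1 m)).2,
      fun α σ => (h2 (α, σ)).1, fun σ => (h2 (fun _ => Classical.arbitrary A, σ)).2⟩
  refine (batchMass_mono p hsub).trans ((batchMass_union_le _ _ _).trans ?_)
  rw [batchMass_not_support, zero_add]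
  refine (batchMass_iUnion_le _ _).trans ?_
  calc ∑ i : (S → A) × (S → Bool), batchMass p M
        ({b | M * ε ≤ ∑ m, rolloutDeviation 𝓜 G lam T π i.1 i.2 (b m)} ∪
          {b | M * ε ≤ ∑ m, stateDeviation 𝓜 G lam ν T π i.2 (b m)})
      ≤ ∑ _i : (S → A) × (S → Bool), ENNReal.ofReal (2 * E) := by
        refine Finset.sum_le_sum fun i _ => (batchMass_union_le _ _ _).trans ?_
        rw [two_mul, ENNReal.ofReal_add (Real.exp_nonneg _) (Real.exp_nonneg _)]
        refine add_le_add ?_ ?_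
        · exact batchMass_hoeffding p _ (hasMean_rolloutDeviation 𝓜 G ν T π i.1 i.2) hR hε
            (fun z hz => abs_rolloutDeviation_le 𝓜 G T π hlam i.1 i.2
              (mem_support_trajectory 𝓜 G hlam ν T π hz).1
              (mem_support_trajectory 𝓜 G hlam ν T π hz).2) M
        · exact batchMass_hoeffding p _ (hasMean_stateDeviation 𝓜 G ν T π i.2) hR hε
            (fun z _ => abs_stateDeviation_le 𝓜 G ν T π hlam i.2 z) M
    _ = _ := by
        rw [Finset.sum_const, Finset.card_univ, Fintype.card_prod, Fintype.card_fun,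
          Fintype.card_fun, Fintype.card_bool, nsmul_eq_mul,
          ← ENNReal.ofReal_natCast, ← ENNReal.ofReal_mul (Nat.cast_nonneg _)]
        congr 1
        push_cast
        rw [mul_pow]
        ring

variable {M : ℕ}

/-- The number `n(s)` of visits to `s`. -/
def visits (b : Fin M → S × A × ℝ) (s : S) : ℝ :=
  ∑ m, if (b m).1 = s then 1 else 0

omit [Fintype S] [Fintype A] [DecidableEq A] [Nonempty A] in
theorem visits_nonneg (b : Fin M → S × A × ℝ) (s : S) : 0 ≤ visits b s :=
  Finset.sum_nonneg fun m _ => by split_ifs <;> simp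

omit [Fintype S] [Fintype A] [DecidableEq A] [Nonempty A] in
theorem visits_eq_zero_iff (b : Fin M → S × A × ℝ) (s : S) :
    visits b s = 0 ↔ ¬ ∃ m, (b m).1 = s := by
  rw [visits, Finset.sum_eq_zero_iff_of_nonneg fun m _ => by split_ifs <;> simp]
  simp

omit [Fintype A] [DecidableEq A] [Nonempty A] in
theorem sum_eq_sum_fiber (b : Fin M → S × A × ℝ) (f : S × A × ℝ → ℝ) :
    ∑ m, f (b m) = ∑ s, ∑ m, if (b m).1 = s then f (b m) else 0 := by
  rw [Finset.sum_comm]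
  exact Finset.sum_congr rfl fun m _ => by simp

omit [Fintype S] [Nonempty A] in
theorem visits_mul_qHat (b : Fin M → S × A × ℝ) (s : S) (a : A) :
    visits b s * qHat b s a =
      Fintype.card A * ∑ m, if (b m).1 = s ∧ (b m).2.1 = a then (b m).2.2 else 0 := by
  by_cases h : visits b s = 0
  · rw [h, zero_mul, Finset.sum_eq_zero fun m _ => ?_, mul_zero]
    have := (visits_eq_zero_iff b s).1 h
    rw [if_neg fun hm => this ⟨m, hm.1⟩]
  · exact mul_div_cancel₀ _ h

omit [Nonempty A] in
-- The estimate has a random denominator, but multiplied by the number of visits its error is a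
-- plain sum over the samples, to which Hoeffding applies.
theorem sum_rolloutDeviation (b : Fin M → S × A × ℝ) (α : S → A) (σ : S → Bool) :
    ∑ m, rolloutDeviation 𝓜 G lam T π α σ (b m) =
      ∑ s, (if σ s then 1 else -1) *
        (visits b s * (qHat b s (α s) - truncatedValue 𝓜 G lam π T s (α s))) := by
  rw [sum_eq_sum_fiber]
  refine Finset.sum_congr rfl fun s _ => ?_
  rw [mul_sub, visits_mul_qHat, visits, Finset.mul_sum, Finset.sum_mul, ← Finset.sum_sub_distrib,
    Finset.mul_sum]
  refine Finset.sum_congr rfl fun m _ => ?_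
  by_cases h : (b m).1 = s
  · subst h
    simp [rolloutDeviation]
  · simp [h]

omit [DecidableEq A] [Nonempty A] in
theorem sum_stateDeviation (b : Fin M → S × A × ℝ) (σ : S → Bool) :
    ∑ m, stateDeviation 𝓜 G lam ν T π σ (b m) = weightedBound 𝓜 G lam *
      ∑ s, if σ s then M * stateLaw 𝓜 ν π T s - visits b s else 0 := by
  simp only [stateDeviation]
  rw [← Finset.mul_sum, Finset.sum_sub_distrib,
    sum_eq_sum_fiber b (fun z => if σ z.1 then 1 else 0), Finset.sum_const, Finset.card_univ,
    Fintype.card_fin, nsmul_eq_mul, Finset.mul_sum, ← Finset.sum_sub_distrib]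
  congr 1
  refine Finset.sum_congr rfl fun s _ => ?_
  have : (∑ m, if (b m).1 = s then (if σ (b m).1 then (1 : ℝ) else 0) else 0) =
      if σ s then visits b s else 0 := by
    rw [visits]
    split_ifs with hs
    · refine Finset.sum_congr rfl fun m _ => ?_
      by_cases h : (b m).1 = s
      · simp [h, hs]
      · simp [h]
    · refine Finset.sum_eq_zero fun m _ => ?_
      by_cases h : (b m).1 = s
      · simp [h, hs]
      · simp [h]
  rw [this]
  split_ifs <;> ring

omit [Fintype S] [Nonempty A] in
theorem qHat_nonneg (b : Fin M → S × A × ℝ) (h : ∀ m, 0 ≤ (b m).2.2) (s : S) (a : A) :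
    0 ≤ qHat b s a :=
  div_nonneg (mul_nonneg (Nat.cast_nonneg _) (Finset.sum_nonneg fun m _ => by
    split_ifs <;> simp [h])) (visits_nonneg b s)

omit [Fintype S] [Nonempty A] in
theorem qHat_le (b : Fin M → S × A × ℝ) {B : ℝ} (hB : 0 ≤ B) (h : ∀ m, (b m).2.2 ≤ B) (s : S)
    (a : A) : qHat b s a ≤ Fintype.card A * B := by
  refine div_le_of_le_mul₀ (visits_nonneg b s) (mul_nonneg (Nat.cast_nonneg _) hB) ?_
  rw [mul_assoc]
  refine mul_le_mul_of_nonneg_left ?_ (Nat.cast_nonneg _)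
  rw [Finset.mul_sum]
  refine Finset.sum_le_sum fun m _ => ?_
  by_cases h1 : (b m).1 = s
  · by_cases h2 : (b m).2.1 = a
    · simpa [h1, h2] using h m
    · simpa [h1, h2] using hB
  · simp [h1]

/-- On good batches the error of the estimated action values, averaged over the law of the sampled
states, is of the order of `ε`. -/
theorem GoodBatch.exists_error (hlam : 0 ≤ lam) (hR : 0 < weightedBound 𝓜 G lam)
    {ε : ℝ} (hM : 0 < M) {b : Fin M → S × A × ℝ} (hb : GoodBatch 𝓜 G lam ν T π ε b)
    (hT : 𝓜.γ ^ T * valueBound 𝓜 G lam ≤ ε) :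
    ∃ e : S → ℝ,
      (∀ s, (∃ m, (b m).1 = s) → ∀ a, |qHat b s a - actionValue 𝓜 G lam π s a| ≤ e s) ∧
      (∀ s, (¬ ∃ m, (b m).1 = s) → 2 * weightedBound 𝓜 G lam ≤ e s) ∧
      ∑ s, stateLaw 𝓜 ν π T s * e s ≤ 4 * ε := by
  classical
  set R := weightedBound 𝓜 G lam with hRdef
  have hMpos : (0 : ℝ) < M := by exact_mod_cast hM
  have hne : Nonempty S := ⟨(b ⟨0, hM⟩).1⟩
  have hBR := valueBound_le_weightedBound 𝓜 G hlam
  have hB0 := valueBound_nonneg 𝓜 G hlam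
  -- The worst action at each state depends on the batch; this is why goodness is required for all α
  -- and σ.
  have hex : ∀ s, ∃ a, ∀ a', |qHat b s a' - truncatedValue 𝓜 G lam π T s a'| ≤
      |qHat b s a - truncatedValue 𝓜 G lam π T s a| := fun s => by
    obtain ⟨a, -, ha⟩ := Finset.exists_max_image Finset.univ
      (fun a => |qHat b s a - truncatedValue 𝓜 G lam π T s a|) Finset.univ_nonempty
    exact ⟨a, fun a' => ha a' (Finset.mem_univ a')⟩
  choose α hα using hex
  set err : S → ℝ := fun s => |qHat b s (α s) - truncatedValue 𝓜 G lam π T s (α s)| with herr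
  have herrR : ∀ s, err s ≤ R := by
    intro s
    have h1 := qHat_nonneg b hb.reward_nonneg s (α s)
    have h2 := qHat_le b hB0 hb.reward_le s (α s)
    have h3 := truncatedValue_nonneg 𝓜 G T π hlam s (α s)
    have h4 := (truncatedValue_le 𝓜 G T π hlam s (α s)).trans hBR
    rw [herr, abs_le]
    change _ ≤ R at h2
    exact ⟨by linarith, by linarith⟩
  have hw : ∑ s, visits b s * err s ≤ M * ε := by
    have h := (hb.rollout_lt α
      (fun s => decide (0 ≤ qHat b s (α s) - truncatedValue 𝓜 G lam π T s (α s)))).le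
    rw [sum_rolloutDeviation] at h
    refine le_trans (le_of_eq (Finset.sum_congr rfl fun s _ => ?_)) h
    rw [herr]
    by_cases hs : 0 ≤ qHat b s (α s) - truncatedValue 𝓜 G lam π T s (α s)
    · simp only [hs, decide_true, if_true, abs_of_nonneg, one_mul]
    · simp only [hs, decide_false, abs_of_neg (not_le.1 hs)]
      simp
      ring
  have hp : R * ∑ s, max (M * stateLaw 𝓜 ν π T s - visits b s) 0 ≤ M * ε := by
    have h := (hb.state_lt (fun s => decide (0 ≤ M * stateLaw 𝓜 ν π T s - visits b s))).le
    rw [sum_stateDeviation] at h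
    refine le_trans (le_of_eq ?_) h
    congr 1
    refine Finset.sum_congr rfl fun s _ => ?_
    by_cases hs : 0 ≤ M * stateLaw 𝓜 ν π T s - visits b s
    · simp [hs]
    · simp only [hs, decide_false, max_eq_right (not_le.1 hs).le]
      simp
  refine ⟨fun s => if ∃ m, (b m).1 = s then err s + ε else 2 * R, ?_, ?_, ?_⟩
  · intro s hs a
    simp only [if_pos hs]
    have h1 := abs_truncatedValue_sub_le 𝓜 G hlam π T s a
    have h2 := hα s a
    have h3 := abs_add_le (qHat b s a - truncatedValue 𝓜 G lam π T s a)
      (truncatedValue 𝓜 G lam π T s a - actionValue 𝓜 G lam π s a)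
    rw [sub_add_sub_cancel] at h3
    simp only [herr]
    linarith
  · intro s hs
    simp only [if_neg hs, le_refl]
  -- Split M p(s) into the visits and a shortfall. The visits carry the weighted error; on the
  -- shortfall the error is at most R, or the assigned 2R if s was not visited. The last term pays
  -- for truncation. Summed over s the three terms give ε, 2ε and ε, times M.
  · have hterm : ∀ s, M * (stateLaw 𝓜 ν π T s *
        (if ∃ m, (b m).1 = s then err s + ε else 2 * R)) ≤
        visits b s * err s + 2 * (R * max (M * stateLaw 𝓜 ν π T s - visits b s) 0)
          + M * ε * stateLaw 𝓜 ν π T s := by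
      intro s
      have hp0 := stateLaw_nonneg 𝓜 ν π T s
      have hε0 : 0 ≤ ε := le_trans (mul_nonneg (pow_nonneg 𝓜.γ_pos.le T) hB0) hT
      have hmax := le_max_left (M * stateLaw 𝓜 ν π T s - visits b s) 0
      have hmax0 := le_max_right (M * stateLaw 𝓜 ν π T s - visits b s) 0
      have herr0 : 0 ≤ err s := abs_nonneg _
      split_ifs with hs
      · have h1 : (M * stateLaw 𝓜 ν π T s - visits b s) * err s ≤
            max (M * stateLaw 𝓜 ν π T s - visits b s) 0 * R :=
          (mul_le_mul_of_nonneg_right hmax herr0).trans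
            (mul_le_mul_of_nonneg_left (herrR s) hmax0)
        have h2 := mul_nonneg hR.le hmax0
        linarith
      · have hv := (visits_eq_zero_iff b s).2 hs
        have h3 : visits b s * err s = 0 := by rw [hv, zero_mul]
        have h4 : R * visits b s = 0 := by rw [hv, mul_zero]
        have h1 := mul_le_mul_of_nonneg_left hmax hR.le
        have h2 := mul_nonneg (mul_nonneg hMpos.le hε0) hp0
        linarith
    have hsum := Finset.sum_le_sum fun s (_ : s ∈ Finset.univ) => hterm s
    rw [← Finset.mul_sum, Finset.sum_add_distrib, Finset.sum_add_distrib, ← Finset.mul_sum,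
      ← Finset.mul_sum, ← Finset.mul_sum, sum_stateLaw] at hsum
    have : M * ∑ s, stateLaw 𝓜 ν π T s * (if ∃ m, (b m).1 = s then err s + ε else 2 * R) ≤
        M * (4 * ε) := by linarith
    exact le_of_mul_le_mul_left this hMpos

end GoodBatch

/-! ### Conditioning a run on its past. -/

section Histories

open MeasureTheory

/-- Atoms of total mass 1 are countably many and carry the whole measure. No measurability of the
event is needed, since ℙ acts as an outer measure on it. -/
theorem measure_mem_le_tsum {Ω β : Type*} [MeasurableSpace Ω] (ℙ : Measure Ω)
    [IsProbabilityMeasure ℙ] (Y : Ω → β) (hY : ∀ y, MeasurableSet {ω | Y ω = y})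
    (hsum : ∑' y, ℙ {ω | Y ω = y} = 1) (E : Set β) :
    ℙ {ω | Y ω ∈ E} ≤ ∑' y, E.indicator (fun y => ℙ {ω | Y ω = y}) y := by
  set f : β → ℝ≥0∞ := fun y => ℙ {ω | Y ω = y} with hf
  have hC : (Function.support f).Countable :=
    Summable.countable_support_ennreal (by rw [hsum]; exact ENNReal.one_ne_top)
  have hcover : ℙ (⋃ y ∈ Function.support f, {ω | Y ω = y}) = 1 := by
    rw [measure_biUnion hC (fun y _ y' _ hne => Set.disjoint_left.2 fun ω h h' =>
      hne (h.symm.trans h')) (fun y _ => hY y), ← hsum]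
    exact tsum_subtype_support f
  have hmeas : MeasurableSet (⋃ y ∈ Function.support f, {ω | Y ω = y}) :=
    MeasurableSet.biUnion hC fun y _ => hY y
  have hnull : ℙ (⋃ y ∈ Function.support f, {ω | Y ω = y})ᶜ = 0 :=
    (prob_compl_eq_zero_iff hmeas).2 hcover
  have hsub : {ω | Y ω ∈ E} ⊆ (⋃ y ∈ Function.support f, {ω | Y ω = y})ᶜ ∪
      ⋃ y ∈ Function.support f ∩ E, {ω | Y ω = y} := by
    intro ω hω
    by_cases h : Y ω ∈ Function.support f
    · exact Or.inr (Set.mem_biUnion (⟨h, hω⟩ : Y ω ∈ Function.support f ∩ E) rfl)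
    · refine Or.inl fun hmem => h ?_
      obtain ⟨y, hy, hyω⟩ := Set.mem_iUnion₂.1 hmem
      have hyω' : Y ω = y := hyω
      rwa [hyω']
  refine (measure_mono hsub).trans ((measure_union_le _ _).trans ?_)
  rw [hnull, zero_add]
  refine (measure_biUnion_le ℙ (hC.mono Set.inter_subset_left) _).trans ?_
  rw [tsum_subtype (Function.support f ∩ E) f]
  exact ENNReal.tsum_le_tsum fun y =>
    Set.indicator_le_indicator_of_subset Set.inter_subset_right (fun _ => zero_le) y

variable {Z : Type*} {M : ℕ → ℕ}

/-- The possible values of the first `n` batches. -/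
def History.{u} (M : ℕ → ℕ) (Z : Type u) : ℕ → Type u
  | 0 => PUnit
  | n + 1 => History M Z n × (Fin (M n) → Z)

/-- A history followed by one more batch. -/
def History.snoc {n : ℕ} (y : History M Z n) (b : Fin (M n) → Z) : History M Z (n + 1) :=
  (y, b)

/-- A history, continued arbitrarily to all batches. -/
def History.extend [Nonempty Z] : ∀ n, History M Z n → ∀ k, Fin (M k) → Z
  | 0, _ => fun _ _ => Classical.arbitrary Z
  | n + 1, y => Function.update (History.extend n y.1) n y.2

/-- The history of the first `n` of the batches `x`. -/
def History.of (x : ∀ k, Fin (M k) → Z) : ∀ n, History M Z n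
  | 0 => PUnit.unit
  | n + 1 => (History.of x n).snoc (x n)

theorem History.extend_snoc_of_lt [Nonempty Z] {n k : ℕ} (y : History M Z n) (b : Fin (M n) → Z)
    (hk : k < n) : History.extend (n + 1) (y.snoc b) k = History.extend n y k :=
  Function.update_of_ne hk.ne _ _

theorem History.extend_snoc_self [Nonempty Z] {n : ℕ} (y : History M Z n) (b : Fin (M n) → Z) :
    History.extend (n + 1) (y.snoc b) n = b :=
  Function.update_self _ _ _

/-- Identifies the atoms of the history with the events whose probability `IsRun.law` prescribes. -/
theorem History.of_eq_iff [Nonempty Z] (x : ∀ k, Fin (M k) → Z) (n : ℕ) (y : History M Z n) :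
    History.of x n = y ↔ ∀ k < n, x k = History.extend n y k := by
  induction n with
  | zero => exact ⟨fun _ k hk => absurd hk (Nat.not_lt_zero k), fun _ => rfl⟩
  | succ n ih =>
    obtain ⟨y, b, rfl⟩ : ∃ (y' : History M Z n) (b : Fin (M n) → Z), y = y'.snoc b :=
      ⟨y.1, y.2, rfl⟩
    have h1 : History.of x (n + 1) = y.snoc b ↔ History.of x n = y ∧ x n = b := Prod.mk_inj
    rw [h1, ih]
    constructor
    · rintro ⟨h, rfl⟩ k hk
      rcases Nat.lt_succ_iff_lt_or_eq.1 hk with hk | rfl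
      · rw [h k hk, History.extend_snoc_of_lt y _ hk]
      · rw [History.extend_snoc_self]
    · intro h
      refine ⟨fun k hk => ?_, ?_⟩
      · rw [h k (hk.trans n.lt_succ_self), History.extend_snoc_of_lt y b hk]
      · rw [h n n.lt_succ_self, History.extend_snoc_self]

variable {S A : Type*} [Fintype A] [DecidableEq S] [DecidableEq A] [Nonempty A]

theorem policySeq_congr (G : Geometry) (lam : ℝ) (t : ℕ → ℝ) {x x' : ∀ k, Fin (M k) → S × A × ℝ}
    {n : ℕ} (h : ∀ k < n, x k = x' k) : policySeq G lam t x n = policySeq G lam t x' n := by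
  induction n with
  | zero => rfl
  | succ n ih =>
    rw [policySeq, policySeq, ih fun k hk => h k (hk.trans n.lt_succ_self), h n n.lt_succ_self]

variable [Fintype S] [Nonempty S] {Ω : Type*} [MeasurableSpace Ω] {ℙ : Measure Ω}
  {𝓜 : MDP S A} {ν : stdSimplex ℝ S} {G : Geometry} {lam : ℝ} {t : ℕ → ℝ} {T : ℕ → ℕ}
  {X : ∀ k, Ω → Fin (M k) → S × A × ℝ}

theorem IsRun.measurableSet_history (h : IsRun ℙ 𝓜 ν G lam t M T X) (n : ℕ)
    (y : History M (S × A × ℝ) n) :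
    MeasurableSet {ω | History.of (fun k => X k ω) n = y} := by
  simp only [History.of_eq_iff]
  have : {ω | ∀ k < n, X k ω = History.extend n y k} =
      ⋂ k ∈ Finset.range n, {ω | X k ω = History.extend n y k} := by
    ext ω
    simp
  rw [this]
  exact Finset.measurableSet_biInter _ fun k _ => h.measurableSet_eq k _

/-- The policy of episode n is a function of the first n batches, so the last factor of the product
law is the conditional law of batch n. -/
theorem IsRun.measure_history_succ (h : IsRun ℙ 𝓜 ν G lam t M T X) (n : ℕ)
    (y : History M (S × A × ℝ) n) (b : Fin (M n) → S × A × ℝ) :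
    ℙ {ω | History.of (fun k => X k ω) (n + 1) = y.snoc b} =
      ℙ {ω | History.of (fun k => X k ω) n = y} *
        ∏ m, trajectory 𝓜 ν G lam (T n) (policySeq G lam t (History.extend n y) n) (b m) := by
  have hagree : ∀ k < n, History.extend (n + 1) (y.snoc b) k = History.extend n y k := fun k hk =>
    History.extend_snoc_of_lt y b hk
  have hlast := History.extend_snoc_self y b
  simp only [History.of_eq_iff]
  rw [h.law, h.law, Finset.prod_range_succ, hlast, policySeq_congr G lam t hagree]
  congr 1
  refine Finset.prod_congr rfl fun k hk => ?_
  rw [Finset.mem_range] at hk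
  rw [hagree k hk, policySeq_congr G lam t fun j hj => hagree j (hj.trans hk)]

theorem IsRun.tsum_history [IsProbabilityMeasure ℙ] (h : IsRun ℙ 𝓜 ν G lam t M T X) (n : ℕ) :
    ∑' y : History M (S × A × ℝ) n, ℙ {ω | History.of (fun k => X k ω) n = y} = 1 := by
  induction n with
  | zero =>
    have : ∀ y : History M (S × A × ℝ) 0, ℙ {ω | History.of (fun k => X k ω) 0 = y} = 1 := by
      intro y
      have : {ω | History.of (fun k => X k ω) 0 = y} = Set.univ := Set.eq_univ_of_forall fun _ => rfl
      rw [this, measure_univ]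
    simp_rw [this]
    change ∑' _y : PUnit, (1 : ℝ≥0∞) = 1
    simp
  | succ n ih =>
    have : ∑' y : History M (S × A × ℝ) n × (Fin (M n) → S × A × ℝ),
        ℙ {ω | History.of (fun k => X k ω) (n + 1) = y} = 1 := by
      rw [ENNReal.tsum_prod', ← ih]
      refine tsum_congr fun y => ?_
      refine (tsum_congr fun b => h.measure_history_succ n y b).trans ?_
      rw [ENNReal.tsum_mul_left, tsum_pi_prod, PMF.tsum_coe, one_pow, mul_one]
    exact this

/-- If, whatever the policy, the batch in episode `n` is bad with probability at most `r`, then the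
batch of a run is bad with probability at most `r`. -/
theorem IsRun.measure_bad_le [IsProbabilityMeasure ℙ] (h : IsRun ℙ 𝓜 ν G lam t M T X) (n : ℕ)
    (Bad : Policy S A → Set (Fin (M n) → S × A × ℝ)) {r : ℝ≥0∞}
    (hr : ∀ π, batchMass (trajectory 𝓜 ν G lam (T n) π) (M n) (Bad π) ≤ r) :
    ℙ {ω | X n ω ∈ Bad (policySeq G lam t (fun k => X k ω) n)} ≤ r := by
  set E : Set (History M (S × A × ℝ) n × (Fin (M n) → S × A × ℝ)) :=
    {y | y.2 ∈ Bad (policySeq G lam t (History.extend n y.1) n)}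
  have hset : {ω | X n ω ∈ Bad (policySeq G lam t (fun k => X k ω) n)} =
      {ω | History.of (fun k => X k ω) (n + 1) ∈ E} := by
    ext ω
    have : policySeq G lam t (fun k => X k ω) n =
        policySeq G lam t (History.extend n (History.of (fun k => X k ω) n)) n :=
      policySeq_congr G lam t ((History.of_eq_iff _ n _).1 rfl)
    change X n ω ∈ Bad (policySeq G lam t (fun k => X k ω) n) ↔
      X n ω ∈ Bad (policySeq G lam t (History.extend n (History.of (fun k => X k ω) n)) n)
    rw [this]
  rw [hset]
  refine (measure_mem_le_tsum ℙ (fun ω => History.of (fun k => X k ω) (n + 1))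
    (h.measurableSet_history (n + 1)) (h.tsum_history (n + 1)) E).trans ?_
  have : ∑' y : History M (S × A × ℝ) n × (Fin (M n) → S × A × ℝ),
      E.indicator (fun y => ℙ {ω | History.of (fun k => X k ω) (n + 1) = y}) y ≤ r := by
    rw [ENNReal.tsum_prod']
    calc _ ≤ ∑' y : History M (S × A × ℝ) n, ℙ {ω | History.of (fun k => X k ω) n = y} * r := by
          refine ENNReal.tsum_le_tsum fun y => ?_
          refine le_trans (le_of_eq ?_) (mul_le_mul_right (hr (policySeq G lam t (History.extend n y) n)) _)
          rw [batchMass, ← ENNReal.tsum_mul_left]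
          refine tsum_congr fun b => ?_
          by_cases hb : b ∈ Bad (policySeq G lam t (History.extend n y) n)
          · rw [Set.indicator_of_mem (show (y, b) ∈ E from hb), Set.indicator_of_mem hb]
            exact h.measure_history_succ n y b
          · rw [Set.indicator_of_notMem (show (y, b) ∉ E from hb), Set.indicator_of_notMem hb,
              mul_zero]
      _ = r := by rw [ENNReal.tsum_mul_right, h.tsum_history n, one_mul]
  exact this

end Histories

/-! ### What the prescribed sample sizes and truncation lengths buy. -/

section SampleSizes

theorem cMaxReg_div_le_rOmega (G : Geometry) (n : ℕ) {C γ lam : ℝ} (hγ : γ < 1)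
    (hC : 0 ≤ cMaxReg G n C lam) (k : ℕ) :
    4 * (n * (cMaxReg G n C lam / (1 - γ))) ≤ rOmega G n C γ lam k := by
  have h0 : 0 ≤ 4 * n * cMaxReg G n C lam / (1 - γ) :=
    div_nonneg (by positivity) (sub_nonneg.2 hγ.le)
  have h1 : 4 * (n * (cMaxReg G n C lam / (1 - γ))) = 4 * n * cMaxReg G n C lam / (1 - γ) := by
    ring
  rw [h1]
  refine le_mul_of_one_le_right h0 ?_
  cases G with
  | euclidean => exact le_rfl
  | nonEuclidean =>
    simp only
    split_ifs
    · exact le_rfl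
    · have : 0 ≤ Real.log ((k : ℝ) + 1) := Real.log_nonneg (by linarith [Nat.cast_nonneg (α := ℝ) k])
      linarith

/-- The numbers `6 δ / (π² (k + 1)²)`, whose sum is `δ`. -/
def failProb (δ : ℝ) (k : ℕ) : ℝ :=
  6 * δ / (Real.pi ^ 2 * ((k : ℝ) + 1) ^ 2)

theorem hasSum_failProb (δ : ℝ) : HasSum (failProb δ) δ := by
  have h := (hasSum_nat_add_iff' 1).2 hasSum_zeta_two
  have h2 := h.mul_left (6 * δ / Real.pi ^ 2)
  have hpi := Real.pi_ne_zero
  have he : ∀ k : ℕ, 6 * δ / Real.pi ^ 2 * (1 / ((k + 1 : ℕ) : ℝ) ^ 2) = failProb δ k := fun k => by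
    rw [failProb]
    push_cast
    field_simp
  have hv : 6 * δ / Real.pi ^ 2 *
      (Real.pi ^ 2 / 6 - ∑ i ∈ Finset.range 1, (1 : ℝ) / (i : ℝ) ^ 2) = δ := by
    simp
    field_simp
  simpa only [he, hv] using h2

/-- As r ≥ 4R, the Hoeffding exponent is at least 4(u + v), with u = S log 2A and e^{-v} the quota
`failProb δ k`. One u absorbs the union bound, and the other three supply e^{-3u} ≤ 1/8. -/
theorem failure_le {S A : ℕ} (hS : 0 < S) (hA : 0 < A) {R r ε δ : ℝ} {M k : ℕ} (hR : 0 < R)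
    (hr : 4 * R ≤ r) (hε : 0 < ε) (hδ : 0 < δ) (hδ1 : δ < 1)
    (hM : r ^ 2 / (2 * ε ^ 2) *
      (S * Real.log (2 * A) + Real.log (Real.pi ^ 2 * (k + 1) ^ 2 / (6 * δ))) ≤ M) :
    0 < M ∧ 2 * (2 * (A : ℝ)) ^ S * Real.exp (-(M * ε ^ 2 / (2 * R ^ 2))) ≤ failProb δ k / 4 := by
  have hA1 : (1 : ℝ) ≤ A := by exact_mod_cast hA
  have hS1 : (1 : ℝ) ≤ S := by exact_mod_cast hS
  have hexpu : Real.exp (S * Real.log (2 * A)) = (2 * (A : ℝ)) ^ S := by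
    rw [Real.exp_nat_mul, Real.exp_log (by linarith)]
  set u := S * Real.log (2 * A) with hu
  have hlog2 : Real.log 2 ≤ u := by
    have h1 : Real.log 2 ≤ Real.log (2 * A) := Real.log_le_log two_pos (by linarith)
    have h2 : 0 ≤ Real.log (2 * A) := Real.log_nonneg (by linarith)
    nlinarith
  have hx1 : 1 < Real.pi ^ 2 * ((k : ℝ) + 1) ^ 2 / (6 * δ) := by
    rw [one_lt_div (by linarith)]
    have h1 : (9 : ℝ) < Real.pi ^ 2 := by nlinarith [Real.pi_gt_three]
    have h2 : (1 : ℝ) ≤ ((k : ℝ) + 1) ^ 2 := one_le_pow₀ (by linarith [Nat.cast_nonneg (α := ℝ) k])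
    nlinarith
  have hexpv : Real.exp (-Real.log (Real.pi ^ 2 * ((k : ℝ) + 1) ^ 2 / (6 * δ))) = failProb δ k := by
    rw [Real.exp_neg, Real.exp_log (by linarith), failProb, inv_div]
  have hv0 : 0 < Real.log (Real.pi ^ 2 * ((k : ℝ) + 1) ^ 2 / (6 * δ)) := Real.log_pos hx1
  set v := Real.log (Real.pi ^ 2 * ((k : ℝ) + 1) ^ 2 / (6 * δ))
  have hu0 : 0 < u := lt_of_lt_of_le (Real.log_pos one_lt_two) hlog2
  have hr2 : (4 * R) ^ 2 / (2 * ε ^ 2) * (u + v) ≤ M := by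
    refine le_trans (mul_le_mul_of_nonneg_right ?_ (by linarith)) hM
    have := pow_le_pow_left₀ (by linarith) hr 2
    gcongr
  have hMpos : (0 : ℝ) < M := lt_of_lt_of_le (by positivity) hr2
  refine ⟨by exact_mod_cast hMpos, ?_⟩
  have hexp : 4 * (u + v) ≤ M * ε ^ 2 / (2 * R ^ 2) := by
    rw [le_div_iff₀ (by positivity)]
    have := mul_le_mul_of_nonneg_right hr2 (sq_nonneg ε)
    have e : (4 * R) ^ 2 / (2 * ε ^ 2) * (u + v) * ε ^ 2 = 4 * (u + v) * (2 * R ^ 2) := by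
      field_simp
      ring
    linarith
  have h8 : Real.exp (-(3 * u)) ≤ 1 / 8 := by
    have h : Real.exp (-(3 * u)) ≤ Real.exp (-(3 * Real.log 2)) :=
      Real.exp_le_exp.2 (by linarith)
    refine h.trans (le_of_eq ?_)
    rw [Real.exp_neg, show (3 : ℝ) * Real.log 2 = ((3 : ℕ) : ℝ) * Real.log 2 by norm_num,
      Real.exp_nat_mul, Real.exp_log two_pos]
    norm_num
  calc 2 * (2 * (A : ℝ)) ^ S * Real.exp (-(M * ε ^ 2 / (2 * R ^ 2)))
      ≤ 2 * Real.exp u * Real.exp (-(4 * (u + v))) := by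
        rw [← hexpu]
        exact mul_le_mul_of_nonneg_left (Real.exp_le_exp.2 (by linarith)) (by positivity)
    _ = 2 * (Real.exp (-(3 * u)) * Real.exp (-(4 * v))) := by
        rw [← Real.exp_add, mul_assoc, ← Real.exp_add]
        congr 2
        ring
    _ ≤ 2 * (1 / 8 * Real.exp (-v)) := by
        have : Real.exp (-(4 * v)) ≤ Real.exp (-v) := Real.exp_le_exp.2 (by linarith)
        gcongr
    _ = failProb δ k / 4 := by rw [hexpv]; ring

/-- From γ ≤ exp(-(1-γ)), the T-th power is at most ε/(8r). -/
theorem pow_mul_le_of_longEnough {γ B r ε : ℝ} {T : ℕ} (hγ0 : 0 < γ) (hγ : γ < 1) (hB : 0 ≤ B)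
    (hr : 0 < r) (hBr : B ≤ r) (hε : 0 < ε)
    (hT : 1 / (1 - γ) * Real.log (8 * r / ε) ≤ T) : γ ^ T * B ≤ ε := by
  have h1γ : 0 < 1 - γ := sub_pos.2 hγ
  have h1 : Real.log (8 * r / ε) ≤ (1 - γ) * T := by
    rw [one_div, inv_mul_le_iff₀ h1γ] at hT
    exact hT
  have h2 : γ ^ T ≤ Real.exp (-((1 - γ) * T)) := by
    have h : γ ≤ Real.exp (-(1 - γ)) := by linarith [Real.add_one_le_exp (-(1 - γ))]
    calc γ ^ T ≤ Real.exp (-(1 - γ)) ^ T := pow_le_pow_left₀ hγ0.le h T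
      _ = Real.exp (-((1 - γ) * T)) := by rw [← Real.exp_nat_mul]; congr 1; ring
  have h3 : γ ^ T ≤ ε / (8 * r) := by
    refine h2.trans ((Real.exp_le_exp.2 (neg_le_neg h1)).trans (le_of_eq ?_))
    rw [Real.exp_neg, Real.exp_log (by positivity), inv_div]
  calc γ ^ T * B ≤ ε / (8 * r) * r := mul_le_mul h3 hBr hB (by positivity)
    _ ≤ ε := by
      have : ε / (8 * r) * r = ε / 8 := by field_simp
      linarith

end SampleSizes

/-! ### The recursion for the averaged Bregman distance. -/

section Recursion

variable {S A : Type*} [Fintype S] [DecidableEq S] [Fintype A] [DecidableEq A] [Nonempty A]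
  [Nonempty S]
variable {𝓜 : MDP S A} {G : Geometry} {lam : ℝ} {μ ν : stdSimplex ℝ S} {t : ℕ → ℝ} {M T : ℕ → ℕ}
  {x : ∀ k, Fin (M k) → S × A × ℝ} {ε H : ℝ}

omit [DecidableEq S] [DecidableEq A] [Fintype A] in
theorem cmax_nonneg (𝓜 : MDP S A) : 0 ≤ 𝓜.Cmax :=
  (𝓜.c_nonneg (Classical.arbitrary S) (Classical.arbitrary A)).trans (𝓜.c_le _ _)

omit [DecidableEq S] [DecidableEq A] in
theorem cMaxReg_nonneg (𝓜 : MDP S A) (G : Geometry) (hlam : 0 ≤ lam) :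
    0 ≤ cMaxReg G (Fintype.card A) 𝓜.Cmax lam := by
  rw [cMaxReg_eq]
  exact add_nonneg (cmax_nonneg 𝓜) (mul_nonneg hlam (cOmega3_nonneg _ _))

omit [DecidableEq S] [DecidableEq A] in
theorem mul_cOmega3_le_valueBound (𝓜 : MDP S A) (G : Geometry) (hlam : 0 ≤ lam) :
    lam * cOmega3 G (Fintype.card A) ≤ valueBound 𝓜 G lam := by
  have h0 := cMaxReg_nonneg 𝓜 G hlam
  have h1 : lam * cOmega3 G (Fintype.card A) ≤ cMaxReg G (Fintype.card A) 𝓜.Cmax lam := by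
    rw [cMaxReg_eq]
    linarith [cmax_nonneg 𝓜]
  refine h1.trans (le_div_self h0 (sub_pos.2 𝓜.γ_lt_one) ?_)
  linarith [𝓜.γ_pos]

theorem policySeq_invariant (hlam : 0 ≤ lam) (ht : ∀ k, 0 < t k) (hlt : ∀ k, lam * t k ≤ 1)
    (hgood : ∀ k, GoodBatch 𝓜 G lam ν (T k) (policySeq G lam t x k) ε (x k)) (k : ℕ) (s : S) :
    IsInterior G (policySeq G lam t x k s) ∧
      LogOscLe G lam (weightedBound 𝓜 G lam) (policySeq G lam t x k s) := by
  have hB := valueBound_nonneg 𝓜 G hlam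
  have hR := hB.trans (valueBound_le_weightedBound 𝓜 G hlam)
  induction k with
  | zero =>
    refine ⟨isInterior_barycenter G, fun _ a b => ?_⟩
    simpa only [policySeq, barycenter_coe, sub_self, mul_zero] using hR
  | succ k ih =>
    rw [policySeq]
    simp only [nextPolicy]
    split_ifs
    · exact ⟨isInterior_policyUpdate G lam (t k) _ _ ih.1,
        ih.2.policyUpdate hlam (ht k).le (hlt k) ih.1
          (qHat_nonneg _ (hgood k).reward_nonneg s) (qHat_le _ hB (hgood k).reward_le s)⟩
    · exact ih

omit [DecidableEq A] [Nonempty A] [Nonempty S] in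
/-- Change of measure from the law of the sampled states to the visitation frequency of `π`. -/
theorem sum_visitation_mul_le {π π' : Policy S A} (hconc : concentrability 𝓜 μ ν π ≠ ⊤)
    {n : ℕ} {e : S → ℝ} (he : ∀ s, 0 ≤ e s) {η : ℝ} (hη : ∑ s, stateLaw 𝓜 ν π' n s * e s ≤ η) :
    ∑ s, visitation 𝓜 μ π s * e s ≤ (concentrability 𝓜 μ ν π).toReal / (1 - 𝓜.γ) * η := by
  have h1γ : 0 < 1 - 𝓜.γ := sub_pos.2 𝓜.γ_lt_one
  set C := (concentrability 𝓜 μ ν π).toReal with hC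
  have hC0 : 0 ≤ C := ENNReal.toReal_nonneg
  refine le_trans ?_ (mul_le_mul_of_nonneg_left hη (div_nonneg hC0 h1γ.le))
  rw [Finset.mul_sum]
  refine Finset.sum_le_sum fun s _ => ?_
  rw [← mul_assoc]
  refine mul_le_mul_of_nonneg_right ?_ (he s)
  refine (visitation_le 𝓜 μ ν π hconc s).trans ?_
  rw [div_mul_eq_mul_div, le_div_iff₀ h1γ, mul_assoc]
  refine mul_le_mul_of_nonneg_left ?_ hC0
  rw [mul_comm]
  exact mul_le_stateLaw 𝓜 ν π' n s

variable (𝓜 G μ) in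
/-- The Bregman distance to `π`, averaged over the visitation frequency of `π`. -/
def potential (π π' : Policy S A) : ℝ :=
  ∑ s, visitation 𝓜 μ π s * bregman G (π s) (π' s)

/-- The term -λB in the Bellman gap becomes the contraction factor 1 - λt. The statewise
inequalities are averaged over the visitation frequency of π, and only their errors are moved to the
sampling law. -/
theorem potential_recursion (hlam : 0 ≤ lam) (ht : ∀ k, 0 < t k) (hlt : ∀ k, lam * t k ≤ 1)
    (hgood : ∀ k, GoodBatch 𝓜 G lam ν (T k) (policySeq G lam t x k) ε (x k))
    (hM : ∀ k, 0 < M k) (hT : ∀ k, 𝓜.γ ^ T k * valueBound 𝓜 G lam ≤ ε)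
    (hR : 0 < weightedBound 𝓜 G lam) (hH0 : 0 ≤ H)
    (hH : ∀ (p : stdSimplex ℝ A) (q : A → ℝ), LogOscLe G lam (weightedBound 𝓜 G lam) p →
      (∀ a, 0 ≤ q a) → (∀ a, q a ≤ valueBound 𝓜 G lam) →
      DualBound G (fun a => q a + lam * gradOmega G p a) H)
    {π : Policy S A} (hconc : concentrability 𝓜 μ ν π ≠ ⊤) (k : ℕ) :
    t k * ((1 - 𝓜.γ) * (scalarValue 𝓜 μ G lam (policySeq G lam t x k)
        - scalarValue 𝓜 μ G lam π)) ≤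
      (1 - lam * t k) * potential 𝓜 G μ π (policySeq G lam t x k)
        - potential 𝓜 G μ π (policySeq G lam t x (k + 1)) + t k ^ 2 * H / 2
        + t k * (8 * (concentrability 𝓜 μ ν π).toReal * ε / (1 - 𝓜.γ)) := by
  obtain ⟨e, he1, he2, he3⟩ := (hgood k).exists_error 𝓜 G ν (T k) _ hlam hR (hM k) (hT k)
  have hinv := policySeq_invariant hlam ht hlt hgood k
  have hnext : policySeq G lam t x (k + 1) = nextPolicy G lam (t k) (policySeq G lam t x k) (x k) :=
    rfl
  rw [hnext]
  set πk := policySeq G lam t x k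
  have he0 : ∀ s, 0 ≤ e s := fun s => by
    by_cases hs : ∃ m, (x k m).1 = s
    · exact (abs_nonneg _).trans (he1 s hs (Classical.arbitrary A))
    · exact le_trans (by linarith) (he2 s hs)
  have hstep : ∀ s, t k * bellmanGap 𝓜 G lam πk π s ≤
      (1 - lam * t k) * bregman G (π s) (πk s)
        - bregman G (π s) (nextPolicy G lam (t k) πk (x k) s) + t k ^ 2 * H / 2
        + t k * (2 * e s) := by
    intro s
    by_cases hs : ∃ m, (x k m).1 = s
    · have hd := policyUpdate_descent G (ht k) (πk s) (hinv s).1 (actionValue 𝓜 G lam πk s)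
        (qHat (x k) s) (he1 s hs) (hH _ _ (hinv s).2 (actionValue_nonneg 𝓜 G hlam πk s)
          (actionValue_le 𝓜 G hlam πk s)) (π s)
      rw [bellmanGap_eq]
      simp only [nextPolicy, if_pos hs]
      linarith
    -- The policy is unchanged here, so gap + λB must be covered by the error alone: it is at most
    -- 3R, while 2e(s) ≥ 4R.
    · simp only [nextPolicy, if_neg hs]
      have h1 := bellmanGap_le 𝓜 G hlam πk π s
      have h2 := mul_bregman_le G hlam (π s) (πk s) (hinv s).1 hR.le (hinv s).2
      have h3 := mul_cOmega3_le_valueBound 𝓜 G hlam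
      have h4 := valueBound_le_weightedBound 𝓜 G hlam
      have h5 := he2 s hs
      have h6 : bellmanGap 𝓜 G lam πk π s + lam * bregman G (π s) (πk s) ≤ 2 * e s := by linarith
      have h7 := mul_le_mul_of_nonneg_left h6 (ht k).le
      have h8 : 0 ≤ t k ^ 2 * H / 2 := by positivity
      linarith
  have hsum := Finset.sum_le_sum fun s (_ : s ∈ Finset.univ) =>
    mul_le_mul_of_nonneg_left (hstep s) (visitation_nonneg 𝓜 μ π s)
  have hl : ∑ s, visitation 𝓜 μ π s * (t k * bellmanGap 𝓜 G lam πk π s) =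
      t k * ((1 - 𝓜.γ) * (scalarValue 𝓜 μ G lam πk - scalarValue 𝓜 μ G lam π)) := by
    rw [← sum_visitation_mul_bellmanGap, Finset.mul_sum]
    exact Finset.sum_congr rfl fun s _ => by ring
  have hr : ∑ s, visitation 𝓜 μ π s * ((1 - lam * t k) * bregman G (π s) (πk s)
        - bregman G (π s) (nextPolicy G lam (t k) πk (x k) s) + t k ^ 2 * H / 2
        + t k * (2 * e s)) =
      (1 - lam * t k) * potential 𝓜 G μ π πk
        - potential 𝓜 G μ π (nextPolicy G lam (t k) πk (x k)) + t k ^ 2 * H / 2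
        + t k * (2 * ∑ s, visitation 𝓜 μ π s * e s) := by
    have : t k ^ 2 * H / 2 = ∑ s, visitation 𝓜 μ π s * (t k ^ 2 * H / 2) := by
      rw [← Finset.sum_mul, sum_visitation, one_mul]
    rw [this]
    simp only [potential, Finset.mul_sum, ← Finset.sum_sub_distrib, ← Finset.sum_add_distrib]
    refine Finset.sum_congr rfl fun s _ => ?_
    rw [← this]
    ring
  rw [hl, hr] at hsum
  have hchange := sum_visitation_mul_le hconc he0 he3
  have h9 := mul_le_mul_of_nonneg_left hchange (ht k).le
  have h10 : t k * (8 * (concentrability 𝓜 μ ν π).toReal * ε / (1 - 𝓜.γ)) =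
      2 * (t k * ((concentrability 𝓜 μ ν π).toReal / (1 - 𝓜.γ) * (4 * ε))) := by ring
  linarith

omit [DecidableEq A] [Nonempty A] [Nonempty S] in
theorem potential_nonneg (π : Policy S A) {π' : Policy S A} (h : ∀ s, IsInterior G (π' s)) :
    0 ≤ potential 𝓜 G μ π π' :=
  Finset.sum_nonneg fun s _ =>
    mul_nonneg (visitation_nonneg 𝓜 μ π s) (bregman_nonneg G _ _ (h s))

omit [Nonempty S] in
theorem potential_zero_le (π : Policy S A) :
    potential 𝓜 G μ π (policySeq G lam t x 0) ≤ cOmega3 G (Fintype.card A) := by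
  calc potential 𝓜 G μ π (policySeq G lam t x 0)
      ≤ ∑ s, visitation 𝓜 μ π s * cOmega3 G (Fintype.card A) := Finset.sum_le_sum fun s _ =>
        mul_le_mul_of_nonneg_left (bregman_barycenter_le G (π s)) (visitation_nonneg 𝓜 μ π s)
    _ = _ := by rw [← Finset.sum_mul, sum_visitation, one_mul]

end Recursion

/-! ### Telescoping the recursion. -/

section Sums

theorem sum_range_inv_le {N : ℕ} (hN : 1 ≤ N) :
    ∑ k ∈ Finset.range (N + 1), ((k : ℝ) + 1)⁻¹ ≤ 2 + Real.log N := by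
  have h := harmonic_le_one_add_log (N + 1)
  rw [harmonic] at h
  push_cast at h
  have hN' : (1 : ℝ) ≤ N := by exact_mod_cast hN
  have h2 : Real.log ((N : ℝ) + 1) ≤ Real.log 2 + Real.log N := by
    rw [← Real.log_mul two_ne_zero (by linarith)]
    exact Real.log_le_log (by linarith) (by linarith)
  have h3 := Real.log_two_lt_d9
  linarith

/-- Telescoping with constant potential weights and stepsizes `c / √(k + 1)`. -/
theorem rate_of_recursion_sqrt {Φ Δ t : ℕ → ℝ} {g c H E m : ℝ} {N : ℕ} (hN : 1 ≤ N) (hg : 0 ≤ g)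
    (hc : 0 < c) (ht : ∀ k, t k = c / √((k : ℝ) + 1)) (hΦ : ∀ k, 0 ≤ Φ k)
    (hrec : ∀ k, t k * (g * Δ k) ≤ Φ k - Φ (k + 1) + t k ^ 2 * H / 2 + t k * E)
    (hH : 0 ≤ H) (hm : ∀ k ≤ N, m ≤ Δ k) :
    g * m ≤ (Φ 0 + c ^ 2 * H / 2 * (2 + Real.log N)) / (c * √(N : ℝ)) + E := by
  have hN' : (1 : ℝ) ≤ N := by exact_mod_cast hN
  have hden : 0 < c * √(N : ℝ) := mul_pos hc (Real.sqrt_pos.2 (by linarith))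
  have htpos : ∀ k, 0 < t k := fun k => by rw [ht]; positivity
  have hsq : ∀ k, t k ^ 2 = c ^ 2 * ((k : ℝ) + 1)⁻¹ := fun k => by
    rw [ht, div_pow, Real.sq_sqrt (by positivity)]
    rfl
  have hstep : ∀ k ∈ Finset.range (N + 1), t k * (g * m - E) ≤
      (Φ k - Φ (k + 1)) + c ^ 2 * H / 2 * ((k : ℝ) + 1)⁻¹ := by
    intro k hk
    have h1 := mul_le_mul_of_nonneg_left (hm k (Nat.lt_succ_iff.1 (Finset.mem_range.1 hk))) hg
    have h2 := mul_le_mul_of_nonneg_left h1 (htpos k).le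
    have h3 := hrec k
    rw [hsq k] at h3
    linarith
  have hsum := Finset.sum_le_sum hstep
  rw [← Finset.sum_mul, Finset.sum_add_distrib, ← Finset.mul_sum, Finset.sum_range_sub'] at hsum
  have hsum2 : (∑ k ∈ Finset.range (N + 1), t k) * (g * m - E) ≤
      Φ 0 + c ^ 2 * H / 2 * (2 + Real.log N) := by
    have h1 := mul_le_mul_of_nonneg_left (sum_range_inv_le hN)
      (show 0 ≤ c ^ 2 * H / 2 by positivity)
    linarith [hΦ (N + 1)]
  have hrhs : 0 ≤ Φ 0 + c ^ 2 * H / 2 * (2 + Real.log N) := by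
    have := hΦ 0
    have := Real.log_nonneg hN'
    positivity
  rw [← sub_le_iff_le_add, le_div_iff₀ hden]
  -- A lower bound on the sum of stepsizes helps only when g m - E is positive; otherwise the claim
  -- is trivial.
  rcases le_or_gt (g * m - E) 0 with hneg | hpos
  · exact (mul_nonpos_of_nonpos_of_nonneg hneg hden.le).trans hrhs
  · refine le_trans ?_ hsum2
    rw [mul_comm]
    refine mul_le_mul_of_nonneg_right ?_ hpos.le
    calc c * √(N : ℝ) ≤ c * √((N : ℝ) + 1) := by gcongr; linarith
      _ = ∑ _k ∈ Finset.range (N + 1), c / √((N : ℝ) + 1) := by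
          rw [Finset.sum_const, Finset.card_range, nsmul_eq_mul]
          push_cast
          rw [mul_div_assoc', mul_comm _ c, mul_div_assoc, Real.div_sqrt]
      _ ≤ ∑ k ∈ Finset.range (N + 1), t k := by
          refine Finset.sum_le_sum fun k hk => ?_
          rw [ht]
          have : (k : ℝ) ≤ N := by exact_mod_cast Nat.lt_succ_iff.1 (Finset.mem_range.1 hk)
          gcongr

/-- Telescoping with contraction and stepsizes `1 / (lam (k + 2))`. -/
theorem rate_of_recursion_inv {Φ Δ t : ℕ → ℝ} {g lam H E m : ℝ} {N : ℕ} (hN : 1 ≤ N) (hg : 0 ≤ g)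
    (hlam : 0 < lam) (ht : ∀ k, t k = 1 / (lam * ((k : ℝ) + 2))) (hΦ : ∀ k, 0 ≤ Φ k)
    (hrec : ∀ k, t k * (g * Δ k) ≤ (1 - lam * t k) * Φ k - Φ (k + 1) + t k ^ 2 * H / 2 + t k * E)
    (hH : 0 ≤ H) (hm : ∀ k ≤ N, m ≤ Δ k) :
    g * m ≤ (lam * Φ 0 + H / (2 * lam) * (2 + Real.log N)) / N + E := by
  have hN' : (1 : ℝ) ≤ N := by exact_mod_cast hN
  -- Multiplying by 1/t_k = λ(k+2) turns the contraction into λ(k+2)(1 - λt_k) = λ(k+1), so the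
  -- weighted potentials λ(k+1)Φ_k telescope.
  have hstep : ∀ k ∈ Finset.range (N + 1), g * m - E ≤
      (lam * ((k : ℝ) + 1) * Φ k - lam * (((k + 1 : ℕ) : ℝ) + 1) * Φ (k + 1))
        + H / (2 * lam) * ((k : ℝ) + 1)⁻¹ := by
    intro k hk
    have h1 := mul_le_mul_of_nonneg_left (hm k (Nat.lt_succ_iff.1 (Finset.mem_range.1 hk))) hg
    have hk0 : (0 : ℝ) < (k : ℝ) + 2 := by positivity
    have hmul := mul_le_mul_of_nonneg_left (hrec k) (mul_pos hlam hk0).le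
    have htk : lam * ((k : ℝ) + 2) * t k = 1 := by rw [ht]; field_simp
    have hlt : lam * ((k : ℝ) + 2) * (1 - lam * t k) = lam * ((k : ℝ) + 1) := by
      rw [ht]; field_simp; ring
    have hsq : lam * ((k : ℝ) + 2) * t k ^ 2 = 1 / (lam * ((k : ℝ) + 2)) := by
      rw [ht]; field_simp
    have e1 : lam * ((k : ℝ) + 2) * (t k * (g * Δ k)) = g * Δ k := by
      rw [← mul_assoc, htk, one_mul]
    have e2 : lam * ((k : ℝ) + 2) *
        ((1 - lam * t k) * Φ k - Φ (k + 1) + t k ^ 2 * H / 2 + t k * E) =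
        lam * ((k : ℝ) + 1) * Φ k - lam * ((k : ℝ) + 2) * Φ (k + 1)
          + 1 / (lam * ((k : ℝ) + 2)) * H / 2 + E := by
      rw [← hlt, ← hsq]
      linear_combination E * htk
    rw [e1, e2] at hmul
    have h3 : 1 / (lam * ((k : ℝ) + 2)) * H / 2 ≤ H / (2 * lam) * ((k : ℝ) + 1)⁻¹ := by
      have : 1 / (lam * ((k : ℝ) + 2)) * H / 2 = H / (2 * lam) * ((k : ℝ) + 2)⁻¹ := by
        field_simp
      rw [this]
      gcongr
      linarith
    push_cast
    rw [show (k : ℝ) + 1 + 1 = (k : ℝ) + 2 by ring]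
    linarith
  have hsum := Finset.sum_le_sum hstep
  rw [Finset.sum_const, Finset.card_range, nsmul_eq_mul, Finset.sum_add_distrib, ← Finset.mul_sum,
    Finset.sum_range_sub' (fun k : ℕ => lam * ((k : ℝ) + 1) * Φ k)] at hsum
  have hlog := Real.log_nonneg hN'
  have hrhs : 0 ≤ lam * Φ 0 + H / (2 * lam) * (2 + Real.log N) := by
    have := hΦ 0
    positivity
  have hsum2 : ((N : ℝ) + 1) * (g * m - E) ≤ lam * Φ 0 + H / (2 * lam) * (2 + Real.log N) := by
    have h1 := mul_le_mul_of_nonneg_left (sum_range_inv_le hN)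
      (show 0 ≤ H / (2 * lam) by positivity)
    have h2 : 0 ≤ lam * (((N + 1 : ℕ) : ℝ) + 1) * Φ (N + 1) := by
      have := hΦ (N + 1)
      positivity
    push_cast at hsum h2
    linarith
  rw [← sub_le_iff_le_add, le_div_iff₀ (by linarith)]
  rcases le_or_gt (g * m - E) 0 with hneg | hpos
  · exact (mul_nonpos_of_nonpos_of_nonneg hneg (by linarith)).trans hrhs
  · linarith

end Sums

/-! ### All batches are good simultaneously. -/

section Probability

open MeasureTheory

variable {S A : Type*} [Fintype S] [DecidableEq S] [Fintype A] [DecidableEq A] [Nonempty A]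
  [Nonempty S]
variable {Ω : Type*} [MeasurableSpace Ω] {ℙ : Measure Ω} [IsProbabilityMeasure ℙ]
  {𝓜 : MDP S A} {ν : stdSimplex ℝ S} {G : Geometry} {lam : ℝ} {t : ℕ → ℝ} {M T : ℕ → ℕ}
  {X : ∀ k, Ω → Fin (M k) → S × A × ℝ} {ε δ : ℝ}

/-- With probability larger than `1 - δ` all batches of a run are good. -/
theorem IsRun.lt_measure_of_good (h : IsRun ℙ 𝓜 ν G lam t M T X) (hlam : 0 ≤ lam)
    (hR : 0 < weightedBound 𝓜 G lam) (hε : 0 < ε) (hδ : 0 < δ) (hδ1 : δ < 1)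
    (hM : EnoughTrajectories G (Fintype.card S) (Fintype.card A) 𝓜.Cmax 𝓜.γ lam ε δ M)
    {P : Ω → Prop}
    (hP : ∀ ω, (∀ k, GoodBatch 𝓜 G lam ν (T k) (policySeq G lam t (fun k => X k ω) k) ε (X k ω)) →
      P ω) :
    ENNReal.ofReal (1 - δ) < ℙ {ω | P ω} := by
  have hbad : ∀ k, ℙ {ω | ¬ GoodBatch 𝓜 G lam ν (T k)
      (policySeq G lam t (fun k => X k ω) k) ε (X k ω)} ≤ ENNReal.ofReal (failProb δ k / 4) := by
    intro k
    refine h.measure_bad_le k (fun π => {b | ¬ GoodBatch 𝓜 G lam ν (T k) π ε b}) fun π => ?_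
    refine (batchMass_not_goodBatch_le 𝓜 G ν (T k) π hlam hR hε (M k)).trans
      (ENNReal.ofReal_le_ofReal ?_)
    exact (failure_le Fintype.card_pos Fintype.card_pos hR
      (cMaxReg_div_le_rOmega G _ 𝓜.γ_lt_one (cMaxReg_nonneg 𝓜 G hlam) k) hε hδ hδ1 (hM k)).2
  have hfail0 : ∀ k, 0 ≤ failProb δ k / 4 := fun k => by rw [failProb]; positivity
  have hcompl : ℙ {ω | P ω}ᶜ ≤ ENNReal.ofReal (δ / 4) := by
    have hsub : {ω | P ω}ᶜ ⊆ ⋃ k, {ω | ¬ GoodBatch 𝓜 G lam ν (T k)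
        (policySeq G lam t (fun k => X k ω) k) ε (X k ω)} := by
      intro ω hω
      by_contra hcon
      rw [Set.mem_iUnion, not_exists] at hcon
      exact hω (hP ω fun k => not_not.1 (hcon k))
    have hs := (hasSum_failProb δ).div_const 4
    calc ℙ {ω | P ω}ᶜ ≤ ∑' k, ENNReal.ofReal (failProb δ k / 4) :=
          (measure_mono hsub).trans ((measure_iUnion_le _).trans (ENNReal.tsum_le_tsum hbad))
      _ = ENNReal.ofReal (δ / 4) := by
          rw [← ENNReal.ofReal_tsum_of_nonneg hfail0 hs.summable, hs.tsum_eq]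
  -- The event may fail to be measurable, so subadditivity replaces complementation; the gap between
  -- δ/4 and δ gives strictness.
  by_contra hcon
  have hle : (1 : ℝ≥0∞) ≤ ENNReal.ofReal (1 - δ) + ENNReal.ofReal (δ / 4) := by
    calc (1 : ℝ≥0∞) = ℙ ({ω | P ω} ∪ {ω | P ω}ᶜ) := by rw [Set.union_compl_self, measure_univ]
      _ ≤ ℙ {ω | P ω} + ℙ {ω | P ω}ᶜ := measure_union_le _ _
      _ ≤ _ := add_le_add (not_lt.1 hcon) hcompl
  rw [← ENNReal.ofReal_add (by linarith) (by linarith), ENNReal.one_le_ofReal] at hle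
  linarith

end Probability

/-! ### The two rates, with explicit constants. -/

section Rates

variable {S A : Type*} [Fintype S] [DecidableEq S] [Fintype A] [DecidableEq A] [Nonempty A]

omit [DecidableEq A] [Nonempty A] in
-- With two or more actions, log A ≥ log 2 > 1/2. This lets additive constants be absorbed into the
-- rates; for one action log A = 0.
theorem half_le_cOmega3 [Nontrivial A] (G : Geometry) : 1 / 2 ≤ cOmega3 G (Fintype.card A) := by
  cases G with
  | euclidean => norm_num [cOmega3]
  | nonEuclidean =>
    have h : (2 : ℝ) ≤ Fintype.card A := by exact_mod_cast Fintype.one_lt_card (α := A)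
    have := Real.log_le_log two_pos h
    simp only [cOmega3]
    linarith [Real.log_two_gt_d9]

omit [DecidableEq A] in
theorem one_le_cOmega1 (G : Geometry) : 1 ≤ cOmega1 G (Fintype.card A) := by
  cases G with
  | euclidean =>
    rw [cOmega1, Real.one_le_sqrt]
    exact_mod_cast Fintype.card_pos (α := A)
  | nonEuclidean => exact le_rfl

omit [DecidableEq A] in
theorem one_le_cOmega2 (G : Geometry) : 1 ≤ cOmega2 G (Fintype.card A) := by
  cases G with
  | euclidean => exact le_rfl
  | nonEuclidean =>
    refine one_le_pow₀ ?_
    exact_mod_cast Fintype.card_pos (α := A)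

omit [DecidableEq S] [DecidableEq A] in
theorem dualBound_unregularized [Nonempty S] (𝓜 : MDP S A) (G : Geometry) (p : stdSimplex ℝ A)
    (q : A → ℝ) (hq0 : ∀ a, 0 ≤ q a) (hq : ∀ a, q a ≤ valueBound 𝓜 G 0) :
    DualBound G (fun a => q a + 0 * gradOmega G p a)
      (4 * cOmega1 G (Fintype.card A) ^ 2 * valueBound 𝓜 G 0 ^ 2) := by
  have hB := valueBound_nonneg 𝓜 G le_rfl
  have h := dualBound_grad G le_rfl p q hq0 hq (R := 0) (Or.inl hB) (fun _ a b => by simp)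
  cases G with
  | euclidean =>
    rw [cOmega1, Real.sq_sqrt (Nat.cast_nonneg _)]
    exact h
  | nonEuclidean =>
    intro a b
    refine (h a b).trans ?_
    simp only [cOmega1]
    nlinarith

omit [DecidableEq S] [DecidableEq A] in
-- In the entropic case the oscillation is at most B + R with R = |A|B, so its square is at most
-- 4|A|²B²: the origin of A² in C_{ω,2}.
theorem dualBound_regularized [Nonempty S] (𝓜 : MDP S A) (G : Geometry) {lam : ℝ} (hlam : 0 ≤ lam)
    (p : stdSimplex ℝ A) (q : A → ℝ) (hp : LogOscLe G lam (weightedBound 𝓜 G lam) p)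
    (hq0 : ∀ a, 0 ≤ q a) (hq : ∀ a, q a ≤ valueBound 𝓜 G lam) :
    DualBound G (fun a => q a + lam * gradOmega G p a)
      (4 * cOmega1 G (Fintype.card A) ^ 2 * cOmega2 G (Fintype.card A) *
        valueBound 𝓜 G lam ^ 2) := by
  have hB := valueBound_nonneg 𝓜 G hlam
  cases G with
  | euclidean =>
    have hlamB : lam ≤ valueBound 𝓜 .euclidean lam := by
      simpa [cOmega3] using mul_cOmega3_le_valueBound 𝓜 .euclidean hlam
    have h := dualBound_grad .euclidean hlam p q hq0 hq (Or.inl hlamB) hp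
    rw [cOmega1, Real.sq_sqrt (Nat.cast_nonneg _)]
    simpa only [cOmega2, mul_one] using h
  | nonEuclidean =>
    have h := dualBound_grad .nonEuclidean hlam p q hq0 hq (Or.inr rfl) hp
    intro a b
    refine (h a b).trans ?_
    have hBR := valueBound_le_weightedBound 𝓜 .nonEuclidean hlam
    calc (valueBound 𝓜 .nonEuclidean lam + weightedBound 𝓜 .nonEuclidean lam) ^ 2
        ≤ (2 * weightedBound 𝓜 .nonEuclidean lam) ^ 2 :=
          pow_le_pow_left₀ (by linarith) (by linarith) 2
      _ = _ := by
          simp only [weightedBound, cOmega1, cOmega2]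
          ring

variable [Nontrivial A] [Nonempty S] {𝓜 : MDP S A} {G : Geometry} {μ ν : stdSimplex ℝ S}
  {t : ℕ → ℝ} {M T : ℕ → ℕ} {x : ∀ k, Fin (M k) → S × A × ℝ} {ε : ℝ} {π : Policy S A}

omit [DecidableEq A] [Nonempty A] [Nontrivial A] [Nonempty S] in
theorem bestValue_le (lam : ℝ) (πs : ℕ → Policy S A) {k N : ℕ} (hk : k ≤ N) :
    bestValue 𝓜 μ G lam πs N ≤ scalarValue 𝓜 μ G lam (πs k) :=
  Finset.inf'_le _ (Finset.mem_range.2 (Nat.lt_succ_of_le hk))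

theorem unregularized_rate (hC : 0 < 𝓜.Cmax)
    (hconc : concentrability 𝓜 μ ν π ≠ ⊤)
    (ht : ∀ k : ℕ, t k =
      (1 - 𝓜.γ) / (cOmega1 G (Fintype.card A) * 𝓜.Cmax * √((k : ℝ) + 1)))
    (hgood : ∀ k, GoodBatch 𝓜 G 0 ν (T k) (policySeq G 0 t x k) ε (x k))
    (hM : ∀ k, 0 < M k) (hT : ∀ k, 𝓜.γ ^ T k * valueBound 𝓜 G 0 ≤ ε)
    (hR : 0 < weightedBound 𝓜 G 0) {N : ℕ} (hN : 1 ≤ N) :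
    bestValue 𝓜 μ G 0 (policySeq G 0 t x) N - scalarValue 𝓜 μ G 0 π ≤
      9 * (cOmega1 G (Fintype.card A) * 𝓜.Cmax *
          (cOmega3 G (Fintype.card A) + Real.log N) / ((1 - 𝓜.γ) ^ 2 * √(N : ℝ))
        + (concentrability 𝓜 μ ν π).toReal * ε / (1 - 𝓜.γ) ^ 2) := by
  have h1γ : 0 < 1 - 𝓜.γ := sub_pos.2 𝓜.γ_lt_one
  have hc1 := one_le_cOmega1 (A := A) G
  have hc3 := half_le_cOmega3 (A := A) G
  set c1 := cOmega1 G (Fintype.card A)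
  set c3 := cOmega3 G (Fintype.card A)
  set C := (concentrability 𝓜 μ ν π).toReal with hCdef
  have hC0 : 0 ≤ C := ENNReal.toReal_nonneg
  have hB0 := valueBound_nonneg 𝓜 G le_rfl
  have hε : 0 ≤ ε := (mul_nonneg (pow_nonneg 𝓜.γ_pos.le _) hB0).trans (hT 0)
  have hBeq : valueBound 𝓜 G 0 = 𝓜.Cmax / (1 - 𝓜.γ) := by
    rw [valueBound, cMaxReg_eq, zero_mul, add_zero]
  have htpos : ∀ k, 0 < t k := fun k => by
    rw [ht]
    have : (0 : ℝ) < √((k : ℝ) + 1) := Real.sqrt_pos.2 (by positivity)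
    exact div_pos h1γ (by positivity)
  have hlt : ∀ k, 0 * t k ≤ 1 := fun k => by rw [zero_mul]; exact zero_le_one
  set H := 4 * c1 ^ 2 * valueBound 𝓜 G 0 ^ 2 with hHdef
  have hH0 : 0 ≤ H := by positivity
  have hrec := potential_recursion (μ := μ) le_rfl htpos hlt hgood hM hT hR hH0
    (fun p q _ hq0 hq => dualBound_unregularized 𝓜 G p q hq0 hq) hconc
  simp only [zero_mul, sub_zero, one_mul] at hrec
  set c := (1 - 𝓜.γ) / (c1 * 𝓜.Cmax) with hcdef
  have hcpos : 0 < c := div_pos h1γ (by positivity)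
  have hrate := rate_of_recursion_sqrt hN h1γ.le hcpos
    (fun k => by rw [ht, hcdef, div_div])
    (fun k => potential_nonneg π fun s => (policySeq_invariant le_rfl htpos hlt hgood k s).1)
    hrec hH0 (m := bestValue 𝓜 μ G 0 (policySeq G 0 t x) N - scalarValue 𝓜 μ G 0 π)
    (fun k hk => sub_le_sub_right (bestValue_le 0 _ hk) _)
  have hcH : c ^ 2 * H = 4 := by
    rw [hcdef, hHdef, hBeq]
    field_simp
  have hlog : 0 ≤ Real.log N := Real.log_nonneg (by exact_mod_cast hN)
  have hsqrt : 0 < √(N : ℝ) := Real.sqrt_pos.2 (by exact_mod_cast hN)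
  -- The left side is at most c3 + 4 + 2 log N, and 4 ≤ 8 c3; this fixes the constant 9.
  have hnum : potential 𝓜 G μ π (policySeq G 0 t x 0) + c ^ 2 * H / 2 * (2 + Real.log N) ≤
      9 * (c3 + Real.log N) := by
    have : potential 𝓜 G μ π (policySeq G 0 t x 0) ≤ c3 := potential_zero_le π
    rw [hcH]
    linarith
  have hfinal : (1 - 𝓜.γ) * (bestValue 𝓜 μ G 0 (policySeq G 0 t x) N - scalarValue 𝓜 μ G 0 π) ≤
      9 * (c3 + Real.log N) / (c * √(N : ℝ)) + 9 * C * ε / (1 - 𝓜.γ) := by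
    refine hrate.trans (add_le_add (by gcongr) ?_)
    gcongr
    norm_num
  refine le_of_mul_le_mul_left (hfinal.trans (le_of_eq ?_)) h1γ
  rw [hcdef]
  field_simp

theorem regularized_rate {lam : ℝ} (hlam : 0 < lam) (hconc : concentrability 𝓜 μ ν π ≠ ⊤)
    (ht : ∀ k : ℕ, t k = 1 / (lam * ((k : ℝ) + 2)))
    (hgood : ∀ k, GoodBatch 𝓜 G lam ν (T k) (policySeq G lam t x k) ε (x k))
    (hM : ∀ k, 0 < M k) (hT : ∀ k, 𝓜.γ ^ T k * valueBound 𝓜 G lam ≤ ε)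
    (hR : 0 < weightedBound 𝓜 G lam) {N : ℕ} (hN : 1 ≤ N) :
    bestValue 𝓜 μ G lam (policySeq G lam t x) N - scalarValue 𝓜 μ G lam π ≤
      9 * (cOmega1 G (Fintype.card A) ^ 2 * cOmega2 G (Fintype.card A) *
          cMaxReg G (Fintype.card A) 𝓜.Cmax lam ^ 2 * (1 + Real.log N) /
          (lam * (1 - 𝓜.γ) ^ 3 * N)
        + (concentrability 𝓜 μ ν π).toReal * ε / (1 - 𝓜.γ) ^ 2) := by
  have h1γ : 0 < 1 - 𝓜.γ := sub_pos.2 𝓜.γ_lt_one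
  have hc1 := one_le_cOmega1 (A := A) G
  have hc2 := one_le_cOmega2 (A := A) G
  have hc3 := half_le_cOmega3 (A := A) G
  have hcm0 := cMaxReg_nonneg 𝓜 G hlam.le
  have hcm : lam * cOmega3 G (Fintype.card A) ≤ cMaxReg G (Fintype.card A) 𝓜.Cmax lam := by
    rw [cMaxReg_eq]
    linarith [cmax_nonneg 𝓜]
  have hBeq : valueBound 𝓜 G lam = cMaxReg G (Fintype.card A) 𝓜.Cmax lam / (1 - 𝓜.γ) := rfl
  set c1 := cOmega1 G (Fintype.card A)
  set c2 := cOmega2 G (Fintype.card A)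
  set c3 := cOmega3 G (Fintype.card A)
  set Cm := cMaxReg G (Fintype.card A) 𝓜.Cmax lam
  set C := (concentrability 𝓜 μ ν π).toReal with hCdef
  have hC0 : 0 ≤ C := ENNReal.toReal_nonneg
  have hB0 := valueBound_nonneg 𝓜 G hlam.le
  have hε : 0 ≤ ε := (mul_nonneg (pow_nonneg 𝓜.γ_pos.le _) hB0).trans (hT 0)
  have htpos : ∀ k, 0 < t k := fun k => by rw [ht]; positivity
  have hlt : ∀ k, lam * t k ≤ 1 := fun k => by
    have hk : (0 : ℝ) < (k : ℝ) + 2 := by positivity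
    have : lam * t k = 1 / ((k : ℝ) + 2) := by rw [ht]; field_simp
    rw [this, div_le_one hk]
    linarith [Nat.cast_nonneg (α := ℝ) k]
  set H := 4 * c1 ^ 2 * c2 * valueBound 𝓜 G lam ^ 2 with hHdef
  have hH0 : 0 ≤ H := by positivity
  have hrec := potential_recursion (μ := μ) hlam.le htpos hlt hgood hM hT hR hH0
    (fun p q hp hq0 hq => dualBound_regularized 𝓜 G hlam.le p q hp hq0 hq) hconc
  have hrate := rate_of_recursion_inv hN h1γ.le hlam ht
    (fun k => potential_nonneg π fun s => (policySeq_invariant hlam.le htpos hlt hgood k s).1)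
    hrec hH0 (m := bestValue 𝓜 μ G lam (policySeq G lam t x) N - scalarValue 𝓜 μ G lam π)
    (fun k hk => sub_le_sub_right (bestValue_le lam _ hk) _)
  have hlog : 0 ≤ Real.log N := Real.log_nonneg (by exact_mod_cast hN)
  have hNpos : (0 : ℝ) < N := by exact_mod_cast hN
  set W := c1 ^ 2 * c2 * Cm ^ 2 / (lam * (1 - 𝓜.γ) ^ 2) with hW
  have hW0 : 0 ≤ W := by positivity
  have hHW : H / (2 * lam) = 2 * W := by
    rw [hHdef, hW, hBeq]
    field_simp
    ring
  -- Since c3 ≥ 1/2 and λc3 ≤ Cm, one has λ²c3 ≤ 2(λc3)² ≤ 2Cm². The initial potential is thus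
  -- absorbed by the gradient term.
  have hinit : lam * c3 ≤ 2 * W := by
    have h1 : (lam * c3) ^ 2 ≤ Cm ^ 2 := pow_le_pow_left₀ (by positivity) hcm 2
    have h2 : lam * c3 * lam ≤ 2 * (lam * c3) ^ 2 := by
      have : 0 ≤ lam ^ 2 * c3 * (2 * c3 - 1) := by
        have : 0 ≤ 2 * c3 - 1 := by linarith
        positivity
      linarith
    have h3 : Cm ^ 2 ≤ c1 ^ 2 * c2 * Cm ^ 2 :=
      le_mul_of_one_le_left (sq_nonneg _) (one_le_mul_of_one_le_of_one_le (one_le_pow₀ hc1) hc2)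
    have h4 : c1 ^ 2 * c2 * Cm ^ 2 / lam ≤ W := by
      rw [hW]
      refine div_le_div_of_nonneg_left (by positivity) (by positivity) ?_
      exact mul_le_of_le_one_right hlam.le (pow_le_one₀ h1γ.le (by linarith [𝓜.γ_pos]))
    have h5 : lam * c3 ≤ 2 * (c1 ^ 2 * c2 * Cm ^ 2 / lam) := by
      rw [mul_div_assoc', le_div_iff₀ hlam]
      linarith
    linarith
  have hnum : lam * potential 𝓜 G μ π (policySeq G lam t x 0) + H / (2 * lam) * (2 + Real.log N) ≤
      9 * (W * (1 + Real.log N)) := by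
    have h0 : potential 𝓜 G μ π (policySeq G lam t x 0) ≤ c3 := potential_zero_le π
    have h1 := mul_le_mul_of_nonneg_left h0 hlam.le
    have h2 := mul_nonneg hW0 hlog
    rw [hHW]
    linarith
  have hfinal : (1 - 𝓜.γ) *
        (bestValue 𝓜 μ G lam (policySeq G lam t x) N - scalarValue 𝓜 μ G lam π) ≤
      9 * (W * (1 + Real.log N)) / N + 9 * C * ε / (1 - 𝓜.γ) := by
    refine hrate.trans (add_le_add (by gcongr) ?_)
    gcongr
    norm_num
  refine le_of_mul_le_mul_left (hfinal.trans (le_of_eq ?_)) h1γ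
  rw [hW]
  field_simp

omit [DecidableEq S] [DecidableEq A] [Nontrivial A] [Nonempty S] in
theorem weightedBound_pos {lam : ℝ} (h : 0 < cMaxReg G (Fintype.card A) 𝓜.Cmax lam) :
    0 < weightedBound 𝓜 G lam :=
  mul_pos (by exact_mod_cast Fintype.card_pos) (div_pos h (sub_pos.2 𝓜.γ_lt_one))

omit [DecidableEq S] [DecidableEq A] [Nontrivial A] in
theorem pow_mul_valueBound_le_of_longEnough {lam : ℝ} (hlam : 0 ≤ lam)
    (h : 0 < cMaxReg G (Fintype.card A) 𝓜.Cmax lam) (hε : 0 < ε)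
    (hT : LongEnough G (Fintype.card A) 𝓜.Cmax 𝓜.γ lam ε T) (k : ℕ) :
    𝓜.γ ^ T k * valueBound 𝓜 G lam ≤ ε := by
  have hR := weightedBound_pos (𝓜 := 𝓜) (G := G) h
  have hr : 4 * weightedBound 𝓜 G lam ≤ _ := cMaxReg_div_le_rOmega G _ 𝓜.γ_lt_one h.le k
  exact pow_mul_le_of_longEnough 𝓜.γ_pos 𝓜.γ_lt_one (valueBound_nonneg 𝓜 G hlam)
    (by linarith) (by linarith [valueBound_le_weightedBound 𝓜 G hlam]) hε (hT k)

omit [DecidableEq S] [DecidableEq A] [Nontrivial A] in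
theorem pos_of_enoughTrajectories {lam δ : ℝ}
    (h : 0 < cMaxReg G (Fintype.card A) 𝓜.Cmax lam) (hε : 0 < ε) (hδ : 0 < δ) (hδ1 : δ < 1)
    (hM : EnoughTrajectories G (Fintype.card S) (Fintype.card A) 𝓜.Cmax 𝓜.γ lam ε δ M) (k : ℕ) :
    0 < M k :=
  (failure_le Fintype.card_pos Fintype.card_pos (weightedBound_pos (𝓜 := 𝓜) (G := G) h)
    (cMaxReg_div_le_rOmega G _ 𝓜.γ_lt_one h.le k) hε hδ hδ1 (hM k)).1

omit [DecidableEq A] [Nonempty A] [Nontrivial A] [Nonempty S] in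
theorem bestValue_sub_eq_zero_of_subsingleton [Subsingleton A] (lam : ℝ) (πs : ℕ → Policy S A)
    (N : ℕ) : bestValue 𝓜 μ G lam πs N - scalarValue 𝓜 μ G lam π = 0 := by
  have : ∀ k, scalarValue 𝓜 μ G lam (πs k) = scalarValue 𝓜 μ G lam π := fun k => by
    rw [Subsingleton.elim (πs k) π]
  simp [bestValue, this]

end Rates

end TRPO

end

theorem theorem2 :
    ∃ K : ℝ, 0 < K ∧
      ∀ (S : Type*) (A : Type*) [Fintype S] [DecidableEq S] [Fintype A] [DecidableEq A] [Nonempty A]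
        (𝓜 : TRPO.MDP S A) (μ ν : stdSimplex ℝ S) (G : TRPO.Geometry)
        (Ω : Type*) [MeasurableSpace Ω] (ℙ : MeasureTheory.Measure Ω)
        [MeasureTheory.IsProbabilityMeasure ℙ] (ε δ : ℝ),
        0 < ε → 0 < δ → δ < 1 →
        -- the unregularized case
        (0 < 𝓜.Cmax →
          ∀ πstar : TRPO.Policy S A, TRPO.IsOptimal 𝓜 G 0 πstar →
          TRPO.concentrability 𝓜 μ ν πstar ≠ ⊤ →
          ∀ M T : ℕ → ℕ,
          TRPO.EnoughTrajectories G (Fintype.card S) (Fintype.card A) 𝓜.Cmax 𝓜.γ 0 ε δ M →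
          TRPO.LongEnough G (Fintype.card A) 𝓜.Cmax 𝓜.γ 0 ε T →
          ∀ t : ℕ → ℝ,
          (∀ k : ℕ, t k =
            (1 - 𝓜.γ) / (TRPO.cOmega1 G (Fintype.card A) * 𝓜.Cmax * √((k : ℝ) + 1))) →
          ∀ X : ∀ k, Ω → Fin (M k) → S × A × ℝ,
          TRPO.IsRun ℙ 𝓜 ν G 0 t M T X →
          ENNReal.ofReal (1 - δ) < ℙ {ω | ∀ N : ℕ, 1 ≤ N →
            TRPO.bestValue 𝓜 μ G 0 (TRPO.policySeq G 0 t fun k => X k ω) N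
                - TRPO.scalarValue 𝓜 μ G 0 πstar ≤
              K * (TRPO.cOmega1 G (Fintype.card A) * 𝓜.Cmax *
                    (TRPO.cOmega3 G (Fintype.card A) + Real.log N) / ((1 - 𝓜.γ) ^ 2 * √(N : ℝ))
                + (TRPO.concentrability 𝓜 μ ν πstar).toReal * ε / (1 - 𝓜.γ) ^ 2)}) ∧
        -- the regularized case
        (∀ lam : ℝ, 0 < lam →
          ∀ πstar : TRPO.Policy S A, TRPO.IsOptimal 𝓜 G lam πstar →
          TRPO.concentrability 𝓜 μ ν πstar ≠ ⊤ →
          ∀ M T : ℕ → ℕ,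
          TRPO.EnoughTrajectories G (Fintype.card S) (Fintype.card A) 𝓜.Cmax 𝓜.γ lam ε δ M →
          TRPO.LongEnough G (Fintype.card A) 𝓜.Cmax 𝓜.γ lam ε T →
          ∀ t : ℕ → ℝ, (∀ k : ℕ, t k = 1 / (lam * ((k : ℝ) + 2))) →
          ∀ X : ∀ k, Ω → Fin (M k) → S × A × ℝ,
          TRPO.IsRun ℙ 𝓜 ν G lam t M T X →
          ENNReal.ofReal (1 - δ) < ℙ {ω | ∀ N : ℕ, 1 ≤ N →
            TRPO.bestValue 𝓜 μ G lam (TRPO.policySeq G lam t fun k => X k ω) N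
                - TRPO.scalarValue 𝓜 μ G lam πstar ≤
              K * (TRPO.cOmega1 G (Fintype.card A) ^ 2 * TRPO.cOmega2 G (Fintype.card A) *
                    TRPO.cMaxReg G (Fintype.card A) 𝓜.Cmax lam ^ 2 * (1 + Real.log N) /
                    (lam * (1 - 𝓜.γ) ^ 3 * N)
                + (TRPO.concentrability 𝓜 μ ν πstar).toReal * ε / (1 - 𝓜.γ) ^ 2)}) := by
  refine ⟨9, by norm_num, ?_⟩
  intro S A _ _ _ _ _ 𝓜 μ ν G Ω _ ℙ _ ε δ hε hδ hδ1
  have hS : Nonempty S := by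
    by_contra hS
    rw [not_nonempty_iff] at hS
    simpa using stdSimplex.sum_eq_one μ
  have h1γ : 0 < 1 - 𝓜.γ := sub_pos.2 𝓜.γ_lt_one
  have hcmax := TRPO.cmax_nonneg 𝓜
  have hc1 := zero_le_one.trans (TRPO.one_le_cOmega1 (A := A) G)
  have hc2 := zero_le_one.trans (TRPO.one_le_cOmega2 (A := A) G)
  have hc3 := TRPO.cOmega3_nonneg G (Fintype.card A)
  have huniv : ∀ P : Ω → Prop, (∀ ω, P ω) → ENNReal.ofReal (1 - δ) < ℙ {ω | P ω} := by
    intro P hP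
    have : {ω | P ω} = Set.univ := Set.eq_univ_of_forall hP
    rw [this, MeasureTheory.measure_univ, ENNReal.ofReal_lt_one]
    linarith
  refine ⟨fun hC πstar _ hconc M T hM hT t ht X hX => ?_,
    fun lam hlam πstar _ hconc M T hM hT t ht X hX => ?_⟩
  -- With a single action all policies coincide and the suboptimality is zero. The general argument
  -- needs C_{ω,3} ≥ 1/2.
  · rcases subsingleton_or_nontrivial A with hA | hA
    · refine huniv _ fun ω N hN => ?_
      rw [TRPO.bestValue_sub_eq_zero_of_subsingleton]
      have := Real.log_natCast_nonneg N
      have := ENNReal.toReal_nonneg (a := TRPO.concentrability 𝓜 μ ν πstar)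
      positivity
    · have hpos : 0 < TRPO.cMaxReg G (Fintype.card A) 𝓜.Cmax 0 := by
        rw [TRPO.cMaxReg_eq, zero_mul, add_zero]
        exact hC
      exact hX.lt_measure_of_good le_rfl (TRPO.weightedBound_pos hpos) hε hδ hδ1 hM
        fun ω hgood N hN => TRPO.unregularized_rate hC hconc ht hgood
          (TRPO.pos_of_enoughTrajectories hpos hε hδ hδ1 hM)
          (TRPO.pow_mul_valueBound_le_of_longEnough le_rfl hpos hε hT)
          (TRPO.weightedBound_pos hpos) hN
  · rcases subsingleton_or_nontrivial A with hA | hA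
    · refine huniv _ fun ω N hN => ?_
      rw [TRPO.bestValue_sub_eq_zero_of_subsingleton]
      have := Real.log_natCast_nonneg N
      have := ENNReal.toReal_nonneg (a := TRPO.concentrability 𝓜 μ ν πstar)
      positivity
    · have hpos : 0 < TRPO.cMaxReg G (Fintype.card A) 𝓜.Cmax lam := by
        rw [TRPO.cMaxReg_eq]
        have := mul_pos hlam (lt_of_lt_of_le one_half_pos (TRPO.half_le_cOmega3 (A := A) G))
        linarith
      exact hX.lt_measure_of_good hlam.le (TRPO.weightedBound_pos hpos) hε hδ hδ1 hM
        fun ω hgood N hN => TRPO.regularized_rate hlam hconc ht hgood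
          (TRPO.pos_of_enoughTrajectories hpos hε hδ hδ1 hM)
          (TRPO.pow_mul_valueBound_le_of_longEnough hlam.le hpos hε hT)
          (TRPO.weightedBound_pos hpos) hN
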